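/- **Theorem (Christoffel-type formulas for a left Geronimus perturbation).** Let $p,q\ge 1$ and let $\mathrm d\mu=(\mathrm d\mu_{b,a})$ be a $q\times p$ matrix of complex (for instance positive) Borel measures on $\mathbb R$ with finite moments of all orders, and let $\Delta\subseteq\mathbb R$ be the union of the supports of its entries. For $k\ge1$ write $X_{[k]}(x)=(I_k,\,xI_k,\,x^2I_k,\dots)^\top$ and assume that the moment matrix $\mathscr M=\int X_{[q]}\,\mathrm d\mu\,X_{[p]}^\top$ has a factorization $\mathscr M=S^{-1}H\bar S^{-\top}$ with $S,\bar S$ lower unitriangular and $H$ diagonal and invertible. Put $A(x)=X_{[p]}^\top(x)\bar S^\top$ and $B(x)=H^{-1}S\,X_{[q]}(x)$, let $A_n=(A_n^{(a)})_{a=1}^p$ be the $n$-th column of $A$ and $B_n=(B_n^{(b)})_{b=1}^q$ the $n$-th row of $B$ ($n\ge 0$), and put $$C_n(z)=\int\frac{\mathrm d\mu(t)}{z-t}A_n(t),\qquad K^{[n]}(x,y)=\sum_{k=0}^nA_k(x)B_k(y),\qquad K_C^{[n]}(x,y)=\sum_{k=0}^nC_k(x)B_k(y).$$ Let $N\ge1$,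 $0\le r<q$, $M=Nq-r$, and let $L(x)=\sum_{l=0}^NL_lx^l$ with $L_l\in\mathbb C^{q\times q}$ and $$L_N=\begin{bmatrix}0_{r\times(q-r)}&0_r\\ I_{q-r}&0_{(q-r)\times r}\end{bmatrix},\qquad L_{N-1}=\begin{bmatrix}*&I_r\\ *&*\end{bmatrix}$$ (same block sizes, $*$ arbitrary), so that $\deg\det L=M$. Assume that $L$ has $M$ distinct (hence simple) eigenvalues $x_1,\dots,x_M\in\mathbb C\setminus\Delta$, and let $v_i^R\ne0$ (column) and $v_i^L\neq0$ (row) be right and left eigenvectors: $L(x_i)v_i^R=0$, $v_i^LL(x_i)=0$. Let $\mathrm d\check\mu$ be a $q\times p$ matrix of complex Borel measures on $\mathbb C$ with finite moments of all orders such that $L\,\mathrm d\check\mu=\mathrm d\mu$ (with $\mathrm d\mu$ regarded as a measure on $\mathbb C$), and assume that the moment matrix of $\check\mu$ also has a factorization as above; denote by $\check A_n^{(a)},\check B_n^{(b)}$ the corresponding polynomials of $\check\mu$ (same normalization). Then there are unique row vectors $\xi_1,\dots,\xi_M\in\mathbb C^{1\times p}$ with $$\mathrm d\check\mu=L^{-1}\,\mathrm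 d\mu+\sum_{i=1}^Mv_i^R\,\xi_i\,\delta_{x_i}.$$ Put, for $n\ge0$ and $1\le i\le M$, $$\mathbb C_n^{(i)}=v_i^LC_n(x_i),\qquad \mathbb W_n^{(i)}=v_i^LL'(x_i)v_i^R\,\xi_iA_n(x_i),$$ $$\mathbb K^{[n],(i)}(y)=v_i^LK_C^{[n]}(x_i,y)-v_i^LL'(x_i)v_i^R\,\xi_iK^{[n]}(x_i,y),$$ $\mathbb E_n^{(i)}=\mathbb C_n^{(i)}-\mathbb W_n^{(i)}$, and, for $n\ge M-1$, $$\tau_n=\begin{vmatrix}\mathbb E_{n-M+1}^{(1)}&\cdots&\mathbb E_n^{(1)}\\ \vdots&&\vdots\\ \mathbb E_{n-M+1}^{(M)}&\cdots&\mathbb E_n^{(M)}\end{vmatrix}.$$ Then $\tau_n\ne0$ for all $n\ge M-1$, and for every $n\ge M$: * for $1\le b\le q$ and $y\in\mathbb C\setminus\{x_1,\dots,x_M\}$, $$\check B_n^{(b)}(y)=-\frac1{\tau_n}\sum_{\tilde b=1}^q\begin{vmatrix}\mathbb E_{n-M+1}^{(1)}&\cdots&\mathbb E_{n-1}^{(1)}&\mathbb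 K_{\tilde b}^{[n-M],(1)}(y)+\dfrac{v_{1;\tilde b}^L}{y-x_1}\\ \vdots&&\vdots&\vdots\\ \mathbb E_{n-M+1}^{(M)}&\cdots&\mathbb E_{n-1}^{(M)}&\mathbb K_{\tilde b}^{[n-M],(M)}(y)+\dfrac{v_{M;\tilde b}^L}{y-x_M}\end{vmatrix}L_{\tilde b,b}(y);$$ * for $1\le a\le p$ and $x\in\mathbb C$, $$\check A_n^{(a)}(x)=\frac1{\tau_{n-1}}\begin{vmatrix}\mathbb E_{n-M}^{(1)}&\cdots&\mathbb E_n^{(1)}\\ \vdots&&\vdots\\ \mathbb E_{n-M}^{(M)}&\cdots&\mathbb E_n^{(M)}\\ A_{n-M}^{(a)}(x)&\cdots&A_n^{(a)}(x)\end{vmatrix}.$$ -/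

import Mathlib

open MeasureTheory Polynomial

noncomputable section

namespace MixedGeronimus

/-- A `q × p` matrix of complex measures on `ℂ`. -/
abbrev MatMeasure (q p : ℕ) := Fin q → Fin p → ComplexMeasure ℂ

/-- The complex bilinear pairing `(z, w) ↦ z * w` used to integrate complex functions against
complex measures. -/
abbrev mulPairing : ℂ →L[ℝ] ℂ →L[ℝ] ℂ := ContinuousLinearMap.mul ℝ ℂ

/-- The integral `∫ f dν` of a complex function against a complex measure. -/
def cint (ν : ComplexMeasure ℂ) (f : ℂ → ℂ) : ℂ := ν.integral f mulPairing

/-- The complex measure `f dν`. -/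
def density (f : ℂ → ℂ) (ν : ComplexMeasure ℂ) : ComplexMeasure ℂ := ν.withDensity f mulPairing

/-- A matrix of complex measures on the real line, regarded as a matrix of measures on `ℂ`
(push-forward under the inclusion of the real line). -/
def lift {q p : ℕ} (μ : Fin q → Fin p → ComplexMeasure ℝ) : MatMeasure q p :=
  fun b a => (μ b a).map (fun t : ℝ => (t : ℂ))

/-- The support `Δ ⊆ ℝ` of a matrix of measures: the union of the (closed) supports of the total
variations of its entries. -/
def matSupport {q p : ℕ} (μ : Fin q → Fin p → ComplexMeasure ℝ) : Set ℝ :=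
  ⋃ (b : Fin q) (a : Fin p), (μ b a).variation.support

/-- All moments of all entries exist. -/
def HasMoments {q p : ℕ} (ν : MatMeasure q p) : Prop :=
  ∀ b a, ∀ k : ℕ, (ν b a).Integrable (fun z : ℂ => z ^ k)

/-- The entries of the monomial matrix `X_[r] = (I_r, x I_r, x² I_r, …)ᵀ`:
the `j`-th row is `x^(j / r)` at position `j % r`. -/
def monom (r : ℕ) [NeZero r] (j : ℕ) (b : Fin r) : ℂ[X] :=
  if Fin.ofNat r j = b then X ^ (j / r) else 0

/-- The moment matrix `∫ X_[q] dν X_[p]ᵀ`. -/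
def momentMatrix {q p : ℕ} [NeZero q] [NeZero p] (ν : MatMeasure q p) : Matrix ℕ ℕ ℂ :=
  fun i j => ∑ b, ∑ a, cint (ν b a) (fun z => (monom q i b).eval z * (monom p j a).eval z)

/-- A Gauss–Borel factorization `𝓜 = S⁻¹ H S̄⁻ᵀ`, i.e. `S 𝓜 S̄ᵀ = H`, with `S`, `S̄` lower
unitriangular and `H` diagonal and invertible. All the sums are finite because the factors are
triangular. Its existence is the existence of the (bi)orthogonality. -/
structure GaussBorel (𝓜 : Matrix ℕ ℕ ℂ) where
  S : Matrix ℕ ℕ ℂ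
  H : ℕ → ℂ
  Sbar : Matrix ℕ ℕ ℂ
  S_upper : ∀ i j, i < j → S i j = 0
  S_diag : ∀ i, S i i = 1
  Sbar_upper : ∀ i j, i < j → Sbar i j = 0
  Sbar_diag : ∀ i, Sbar i i = 1
  H_ne : ∀ i, H i ≠ 0
  factor : ∀ i j, ∑ k ∈ Finset.range (i + 1), ∑ l ∈ Finset.range (j + 1),
    S i k * 𝓜 k l * Sbar j l = if i = j then H i else 0

section Polynomials

variable {q p : ℕ} [NeZero q] [NeZero p] {ν : MatMeasure q p}

/-- The polynomials `A_n^(a)`, the entries of the monic family `A = X_[p]ᵀ S̄ᵀ`. -/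
def polyA (F : GaussBorel (momentMatrix ν)) (n : ℕ) (a : Fin p) : ℂ[X] :=
  ∑ j ∈ Finset.range (n + 1), C (F.Sbar n j) * monom p j a

/-- The polynomials `B_n^(b)`, the entries of `B = H⁻¹ S X_[q]`. -/
def polyB (F : GaussBorel (momentMatrix ν)) (n : ℕ) (b : Fin q) : ℂ[X] :=
  ∑ j ∈ Finset.range (n + 1), C (F.S n j / F.H n) * monom q j b

/-- The entries of the Cauchy transform `C_n(z) = ∫ dν(t) A_n(t) / (z - t)`. -/
def cauchyC (F : GaussBorel (momentMatrix ν)) (n : ℕ) (z : ℂ) (b : Fin q) : ℂ :=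
  ∑ a, cint (ν b a) (fun t => (polyA F n a).eval t / (z - t))

/-- The Christoffel–Darboux kernel `K^[n](x, y) = ∑_{i ≤ n} A_i(x) B_i(y)`. -/
def kernelK (F : GaussBorel (momentMatrix ν)) (n : ℕ) (x y : ℂ) : Matrix (Fin p) (Fin q) ℂ :=
  fun a b => ∑ i ∈ Finset.range (n + 1), (polyA F i a).eval x * (polyB F i b).eval y

/-- The mixed Christoffel–Darboux kernel `K_C^[n](x, y) = ∑_{i ≤ n} C_i(x) B_i(y)`. -/
def kernelKC (F : GaussBorel (momentMatrix ν)) (n : ℕ) (x y : ℂ) : Matrix (Fin q) (Fin q) ℂ :=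
  fun c b => ∑ i ∈ Finset.range (n + 1), cauchyC F i x c * (polyB F i b).eval y

end Polynomials

section MatrixPolynomial

variable {q : ℕ}

/-- The value `L(z)` of a matrix polynomial. -/
def evalMat (L : Matrix (Fin q) (Fin q) ℂ[X]) (z : ℂ) : Matrix (Fin q) (Fin q) ℂ :=
  L.map (fun f => f.eval z)

/-- The value `L'(z)` of the derivative of a matrix polynomial. -/
def evalDeriv (L : Matrix (Fin q) (Fin q) ℂ[X]) (z : ℂ) : Matrix (Fin q) (Fin q) ℂ :=
  L.map (fun f => (derivative f).eval z)

/-- `L(x) = ∑_{l ≤ N} L_l x^l` with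
`L_N = [[0, 0_r], [I_{q-r}, 0]]` and `L_{N-1} = [[*, I_r], [*, *]]`, where in both cases the upper
block row has height `r` and the left block column has width `q - r`. -/
structure IsNormalized (L : Matrix (Fin q) (Fin q) ℂ[X]) (N r : ℕ) : Prop where
  degree_le : ∀ b c, (L b c).natDegree ≤ N
  leading : ∀ b c : Fin q, (L b c).coeff N = if (b : ℕ) = c + r then 1 else 0
  subleading : ∀ b c : Fin q, (b : ℕ) < r → q ≤ (c : ℕ) + r →
    (L b c).coeff (N - 1) = if (c : ℕ) + r = b + q then 1 else 0

/-- `M` pairwise distinct eigenvalues of `L`, with right and left eigenvectors. It is used with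
`M = deg det L`; then these are all the eigenvalues and all of them are simple. -/
structure EigenData (L : Matrix (Fin q) (Fin q) ℂ[X]) (M : ℕ) where
  x : Fin M → ℂ
  vR : Fin M → Fin q → ℂ
  vL : Fin M → Fin q → ℂ
  x_injective : Function.Injective x
  vR_ne : ∀ i, vR i ≠ 0
  vL_ne : ∀ i, vL i ≠ 0
  right_eigen : ∀ i, (evalMat L (x i)).mulVec (vR i) = 0
  left_eigen : ∀ i, Matrix.vecMul (vL i) (evalMat L (x i)) = 0

end MatrixPolynomial

section Perturbation

variable {q p M : ℕ} {L : Matrix (Fin q) (Fin q) ℂ[X]}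

/-- `ν'` is a matrix of measures with finite moments such that `L(z) dν'(z) = dν(z)`. -/
structure IsLeftGeronimus (L : Matrix (Fin q) (Fin q) ℂ[X]) (ν ν' : MatMeasure q p) : Prop where
  moments : HasMoments ν'
  perturb : ∀ b a, ∑ c, density (fun z => evalMat L z b c) (ν' c a) = ν b a

/-- `dν' = L⁻¹ dν + ∑_i v_i^R ξ_i δ_{x_i}`, with row vectors `ξ_i` of size `p`. -/
def HasMasses (D : EigenData L M) (ξ : Fin M → Fin p → ℂ) (ν ν' : MatMeasure q p) : Prop :=
  ∀ b a, ν' b a = ∑ c, density (fun z => (evalMat L z)⁻¹ b c) (ν c a) +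
    ∑ i, VectorMeasure.dirac (D.x i) (D.vR i b * ξ i a)

variable [NeZero q] [NeZero p] {ν : MatMeasure q p}

/-- The scalar `v_i^L L'(x_i) v_i^R`. -/
def scal (D : EigenData L M) (i : Fin M) : ℂ :=
  dotProduct (D.vL i) ((evalDeriv L (D.x i)).mulVec (D.vR i))

/-- `ℂ_n^(i) = v_i^L C_n(x_i)`. -/
def bbC (F : GaussBorel (momentMatrix ν)) (D : EigenData L M) (n : ℕ) (i : Fin M) : ℂ :=
  ∑ b, D.vL i b * cauchyC F n (D.x i) b

/-- `𝕎_n^(i) = v_i^L L'(x_i) v_i^R ξ_i A_n(x_i)`. -/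
def bbW (F : GaussBorel (momentMatrix ν)) (D : EigenData L M) (ξ : Fin M → Fin p → ℂ)
    (n : ℕ) (i : Fin M) : ℂ :=
  scal D i * ∑ a, ξ i a * (polyA F n a).eval (D.x i)

/-- The entry `b` of
`𝕂^[n],(i)(y) = v_i^L K_C^[n](x_i, y) - v_i^L L'(x_i) v_i^R ξ_i K^[n](x_i, y)`. -/
def bbK (F : GaussBorel (momentMatrix ν)) (D : EigenData L M) (ξ : Fin M → Fin p → ℂ)
    (n : ℕ) (i : Fin M) (y : ℂ) (b : Fin q) : ℂ :=
  ∑ c, D.vL i c * kernelKC F n (D.x i) y c b -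
    scal D i * ∑ a, ξ i a * kernelK F n (D.x i) y a b

/-- `τ_n`, for `n ≥ M - 1`: the determinant with rows indexed by the eigenvalues and columns
`ℂ_k - 𝕎_k`, `k = n - M + 1, …, n`. -/
def tau (F : GaussBorel (momentMatrix ν)) (D : EigenData L M) (ξ : Fin M → Fin p → ℂ)
    (n : ℕ) : ℂ :=
  Matrix.det (Matrix.of fun i j : Fin M =>
    bbC F D (n + 1 - M + j) i - bbW F D ξ (n + 1 - M + j) i)

/-- The determinant with columns `ℂ_k - 𝕎_k`, `k = n - M + 1, …, n - 1`, and last column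
`𝕂_b^[n-M],(i)(y) + v_{i;b}^L / (y - x_i)`, for `n ≥ M ≥ 1`. -/
def detB (F : GaussBorel (momentMatrix ν)) (D : EigenData L M) (ξ : Fin M → Fin p → ℂ)
    (n : ℕ) (y : ℂ) (b : Fin q) : ℂ :=
  Matrix.det (Matrix.of fun i j : Fin M =>
    if (j : ℕ) + 1 < M then
      bbC F D (n - M + 1 + j) i - bbW F D ξ (n - M + 1 + j) i
    else
      bbK F D ξ (n - M) i y b + D.vL i b / (y - D.x i))

/-- The bordered determinant with columns indexed by `k = n - M, …, n`, first `M` rows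
`ℂ_k^(i) - 𝕎_k^(i)` and last row `A_k^(a)(x)`, for `n ≥ M`. -/
def detA (F : GaussBorel (momentMatrix ν)) (D : EigenData L M) (ξ : Fin M → Fin p → ℂ)
    (n : ℕ) (x : ℂ) (a : Fin p) : ℂ :=
  Matrix.det (Matrix.of fun i j : Fin (M + 1) =>
    if h : (i : ℕ) < M then
      bbC F D (n - M + j) ⟨i, h⟩ - bbW F D ξ (n - M + j) ⟨i, h⟩
    else
      (polyA F (n - M + j) a).eval x)

end Perturbation

end MixedGeronimus

end

/-! The proof turns the perturbation into linear algebra over two bilinear forms on vector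
polynomials, β(u, w) = ∫ u dμ w and β'(u, w) = ∫ u dμ̌ w. Order the vector monomials x^k e_b of size
r by the index rk + b. The relation L dμ̌ = dμ reads β'(uL, w) = β(u, w), and the block shape of L_N
and L_{N-1} says exactly that u ↦ uL raises the index degree by M and preserves the leading
coefficient (`IsNormalized.idxCoeff_mulRight`).

The row polynomials of index less than M, which uL does not reach, are spanned by R_i = v_i^L
L(x)/(x - x_i): these are M independent elements of a space of dimension at most M. Moreover E_n^(i)
= -β'(R_i, A_n) (`bbC_sub_bbW`): the density L⁻¹dμ yields the Cauchy transform and the atoms yield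
𝕎. A combination w of A_m, A_{m+1}, … is thus β'-orthogonal to all rows of index less than m + M as
soon as the M conditions β'(R_i, w) = 0 hold, and these form a linear system with matrix (E_k^(i)).

Three consequences follow. A null vector of that system would contradict nondegeneracy of β', so τ ≠
0 (`GeronimusData.det_ne_zero`). Cramer's rule produces Ǎ_n (`GeronimusData.det_right`). Dually, Z_i
= R_i + ∑_{k ≤ m} E_k^(i) B_k L is β'-orthogonal to A_0, …, A_m, and a cofactor combination of the
Z_i is a multiple of B̌_{m+M} (`GeronimusData.det_left`).

For the masses, det L annihilates μ̌ - L⁻¹μ, so this difference is carried by the zeros of det L.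
The same basis R_i shows that these zeros are the x_i, with one-dimensional kernels. The atom of
each column of μ̌ at x_i lies in the right kernel of L(x_i), hence is a multiple of v_i^R
(`exists_masses`). -/

namespace MixedGeronimus

/-! ### Integrals against a complex measure with a density. -/

section ComplexMeasureIntegral

variable {X : Type*} [MeasurableSpace X] {ν : ComplexMeasure X} {f g : X → ℂ}

lemma norm_mulPairing (x y : ℂ) : ‖mulPairing x y‖₊ = ‖x‖₊ * ‖y‖₊ := by
  simp [mulPairing]

lemma variation_withDensity_mulPairing (hg : ν.Integrable g) :
    (ν.withDensity g mulPairing).variation = ν.variation.withDensity (fun x => ‖g x‖ₑ) := by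
  rw [VectorMeasure.variation_withDensity hg norm_mulPairing,
    VectorMeasure.variation_transpose_eq _ _ norm_mulPairing]

lemma integrable_withDensity_enorm_iff {m : Measure X} (hg : AEStronglyMeasurable g m)
    (hfm : AEStronglyMeasurable f m) :
    Integrable f (m.withDensity fun x => ‖g x‖ₑ) ↔ Integrable (fun x => f x * g x) m := by
  have h1 : AEMeasurable (fun x => ‖g x‖₊) m := hg.nnnorm.aemeasurable
  have := integrable_withDensity_iff_integrable_smul₀ (E := ℂ) (g := f) h1
  simp only [enorm_eq_nnnorm]
  rw [this, ← integrable_norm_iff (by exact hg.nnnorm.aemeasurable.aestronglyMeasurable.smul hfm),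
    ← integrable_norm_iff (f := fun x => f x * g x) (hfm.mul hg)]
  simp [mul_comm, NNReal.smul_def]

/-- The weighted measure does not see the zero set of g, but both products vanish there. -/
lemma mul_ae_eq_of_withDensity {m : Measure X} {h : X → ℂ} (hg : AEStronglyMeasurable g m)
    (hfh : f =ᵐ[m.withDensity fun x => ‖g x‖ₑ] h) :
    (fun x => f x * g x) =ᵐ[m] fun x => h x * g x := by
  have H := (ae_withDensity_iff' hg.enorm).1 hfh
  filter_upwards [H] with x hx
  rcases eq_or_ne (g x) 0 with h0 | h0
  · simp [h0]
  · rw [hx (by simpa using h0)]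

lemma integrable_mul_of_withDensity {m : Measure X} (hg : AEStronglyMeasurable g m)
    (hf : Integrable f (m.withDensity fun x => ‖g x‖ₑ)) : Integrable (fun x => f x * g x) m := by
  have h1 := hf.congr hf.1.ae_eq_mk
  exact ((integrable_withDensity_enorm_iff hg
    hf.1.stronglyMeasurable_mk.aestronglyMeasurable).1 h1).congr
    (mul_ae_eq_of_withDensity hg hf.1.ae_eq_mk.symm)

/-- The L¹ norm for the measure weighted by |g| is the integral of |f g|, so the map is Lipschitz.
This gives the closedness step in the induction on integrable functions below. -/
lemma continuous_integral_mul {m : Measure X} (hg : ν.Integrable g)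
    (hm : m = ν.variation.withDensity fun x => ‖g x‖ₑ) :
    Continuous fun f : X →₁[m] ℂ => ν.integral (fun x => f x * g x) mulPairing := by
  subst hm
  set m := ν.variation.withDensity fun x => ‖g x‖ₑ
  have hi (f : X →₁[m] ℂ) : ν.Integrable (fun x => f x * g x) :=
    integrable_mul_of_withDensity hg.1 (L1.integrable_coeFn f)
  refine (LipschitzWith.of_dist_le_mul (K := ‖mulPairing‖₊) fun f h => ?_).continuous
  rw [dist_eq_norm, dist_eq_norm, ← VectorMeasure.integral_fun_sub (hi f) (hi h)]
  refine VectorMeasure.norm_integral_le_lintegral_norm.trans ?_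
  rw [coe_nnnorm]
  refine mul_le_mul_of_nonneg_left (le_of_eq ?_) (by positivity)
  rw [L1.norm_def, lintegral_withDensity_eq_lintegral_mul₀ hg.1.enorm
    (Lp.stronglyMeasurable (f - h)).measurable.enorm.aemeasurable]
  congr 1
  refine lintegral_congr_ae ?_
  filter_upwards [mul_ae_eq_of_withDensity hg.1 (Lp.coeFn_sub f h)] with x hx
  rw [Pi.sub_apply, sub_mul] at hx
  rw [← hx, ofReal_norm, enorm_mul, mul_comm, Pi.mul_apply]

lemma integral_const_mul (c : ℂ) :
    ν.integral (fun x => c * f x) mulPairing = c * ν.integral f mulPairing :=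
  setToFun_smul _ (fun c s x => mul_assoc c x (ν s)) c f

lemma integral_withDensity_mulPairing (hg : ν.Integrable g)
    (hf : (ν.withDensity g mulPairing).Integrable f) :
    (ν.withDensity g mulPairing).integral f mulPairing =
      ν.integral (fun x => f x * g x) mulPairing := by
  have hv := variation_withDensity_mulPairing hg
  have hfin : IsFiniteMeasure (ν.withDensity g mulPairing).variation := by
    rw [hv]
    exact isFiniteMeasure_withDensity (by simpa using! hg.2.ne)
  revert f
  refine Integrable.induction _ (fun c s hs _ => ?_) (fun f h _ hf hh hPf hPh => ?_) ?_
    (fun f h hfh _ hP => ?_)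
  · have h1 : (fun x => s.indicator (fun _ => c) x * g x) = s.indicator (fun x => c * g x) := by
      ext x
      by_cases hx : x ∈ s <;> simp [hx]
    rw [h1, VectorMeasure.integral_indicator hs, VectorMeasure.integral_indicator hs,
      VectorMeasure.integral_const, VectorMeasure.restrict_apply _ hs .univ, Set.univ_inter,
      VectorMeasure.withDensity_apply hg]
    exact (integral_const_mul c).symm
  · rw [hv] at hf hh
    have h1 := integrable_mul_of_withDensity hg.1 hf
    have h2 := integrable_mul_of_withDensity hg.1 hh
    rw [← hv] at hf hh
    rw [VectorMeasure.integral_add hf hh, hPf, hPh, ← VectorMeasure.integral_fun_add h1 h2]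
    simp [add_mul]
  · exact isClosed_eq VectorMeasure.continuous_integral (continuous_integral_mul hg hv)
  · rw [← VectorMeasure.integral_congr_ae hfh, hP]
    rw [hv] at hfh
    exact VectorMeasure.integral_congr_ae (mul_ae_eq_of_withDensity hg.1 hfh)

end ComplexMeasureIntegral

/-! ### Calculus of `cint` and `density`. -/

section Integration

variable {ν ν₁ ν₂ : ComplexMeasure ℂ} {f g : ℂ → ℂ}

lemma cint_const_mul (c : ℂ) : cint ν (fun z => c * f z) = c * cint ν f :=
  integral_const_mul c

lemma cint_neg : cint ν (fun z => -f z) = -cint ν f :=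
  VectorMeasure.integral_fun_neg ν mulPairing f

lemma cint_add (hf : ν.Integrable f) (hg : ν.Integrable g) :
    cint ν (fun z => f z + g z) = cint ν f + cint ν g :=
  VectorMeasure.integral_fun_add hf hg

lemma cint_finsetSum {ι : Type*} (s : Finset ι) {f : ι → ℂ → ℂ}
    (hf : ∀ i ∈ s, ν.Integrable (f i)) :
    cint ν (fun z => ∑ i ∈ s, f i z) = ∑ i ∈ s, cint ν (f i) :=
  VectorMeasure.integral_finsetSum s hf

lemma cint_congr_ae (h : f =ᵐ[ν.variation] g) : cint ν f = cint ν g :=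
  VectorMeasure.integral_congr_ae h

lemma cint_measure_add (h₁ : ν₁.Integrable f) (h₂ : ν₂.Integrable f) :
    cint (ν₁ + ν₂) f = cint ν₁ f + cint ν₂ f :=
  VectorMeasure.integral_add_vectorMeasure h₁ h₂

lemma cint_measure_finsetSum {ι : Type*} (s : Finset ι) {ν : ι → ComplexMeasure ℂ}
    (h : ∀ i ∈ s, (ν i).Integrable f) : cint (∑ i ∈ s, ν i) f = ∑ i ∈ s, cint (ν i) f :=
  VectorMeasure.integral_finsetSum_vectorMeasure h

lemma cint_dirac (x c : ℂ) : cint (VectorMeasure.dirac x c) f = f x * c := by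
  simp [cint, mulPairing]

lemma integrable_dirac (x c : ℂ) : (VectorMeasure.dirac x c).Integrable f := by
  rw [VectorMeasure.Integrable, VectorMeasure.variation_dirac]
  exact (MeasureTheory.integrable_dirac (by simp)).smul_measure (by simp)

lemma variation_density (hg : ν.Integrable g) :
    (density g ν).variation = ν.variation.withDensity (fun x => ‖g x‖ₑ) :=
  variation_withDensity_mulPairing hg

lemma integrable_density (hg : ν.Integrable g) (hfm : AEStronglyMeasurable f ν.variation)
    (hfg : ν.Integrable (fun z => f z * g z)) : (density g ν).Integrable f := by
  rw [VectorMeasure.Integrable, variation_density hg]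
  exact (integrable_withDensity_enorm_iff hg.1 hfm).2 hfg

lemma cint_density (hg : ν.Integrable g) (hfm : AEStronglyMeasurable f ν.variation)
    (hfg : ν.Integrable (fun z => f z * g z)) :
    cint (density g ν) f = cint ν (fun z => f z * g z) :=
  integral_withDensity_mulPairing hg (integrable_density hg hfm hfg)

lemma density_apply (hf : ν.Integrable f) (s : Set ℂ) :
    density f ν s = cint (ν.restrict s) f :=
  VectorMeasure.withDensity_apply hf

lemma density_density (hg : ν.Integrable g) (hfm : AEStronglyMeasurable f ν.variation)
    (hfg : ν.Integrable (fun z => f z * g z)) :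
    density f (density g ν) = density (fun z => f z * g z) ν := by
  ext s hs
  rw [density_apply (integrable_density hg hfm hfg), density_apply hfg,
    density, VectorMeasure.restrict_withDensity hg]
  refine cint_density hg.restrict ?_ hfg.restrict
  rw [VectorMeasure.variation_restrict hs]
  exact hfm.restrict

lemma density_finsetSum {ι : Type*} (s : Finset ι) {f : ι → ℂ → ℂ}
    (hf : ∀ i ∈ s, ν.Integrable (f i)) :
    density (fun z => ∑ i ∈ s, f i z) ν = ∑ i ∈ s, density (f i) ν := by
  ext t ht
  rw [density_apply (integrable_finsetSum s hf), cint_finsetSum s fun i hi => (hf i hi).restrict,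
    FunLike.coe_sum, Finset.sum_apply]
  exact Finset.sum_congr rfl fun i hi => (density_apply (hf i hi) t).symm

lemma density_measure_finsetSum {ι : Type*} (s : Finset ι) {ν : ι → ComplexMeasure ℂ}
    (h : ∀ i ∈ s, (ν i).Integrable f) : density f (∑ i ∈ s, ν i) = ∑ i ∈ s, density f (ν i) := by
  ext t ht
  rw [density_apply (VectorMeasure.Integrable.finsetSum_vectorMeasure h),
    FunLike.coe_sum, Finset.sum_apply,
    show (∑ i ∈ s, ν i).restrict t = ∑ i ∈ s, (ν i).restrict t from
      map_sum (VectorMeasure.restrictGm t) ν s,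
    cint_measure_finsetSum s fun i hi => (h i hi).restrict]
  exact Finset.sum_congr rfl fun i hi => (density_apply (h i hi) t).symm

lemma density_measure_sub (h₁ : ν₁.Integrable f) (h₂ : ν₂.Integrable f) :
    density f (ν₁ - ν₂) = density f ν₁ - density f ν₂ := by
  ext t ht
  rw [density_apply (h₁.sub_vectorMeasure h₂), sub_apply, density_apply h₁,
    density_apply h₂, VectorMeasure.restrict_sub]
  exact VectorMeasure.integral_sub_vectorMeasure h₁.restrict h₂.restrict

lemma density_congr_ae (h : f =ᵐ[ν.variation] g) : density f ν = density g ν :=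
  VectorMeasure.withDensity_congr h

end Integration

/-! ### Integration of polynomials. -/

section Moments

variable {q p : ℕ} {ν : MatMeasure q p}

lemma HasMoments.integrable_eval (h : HasMoments ν) (b : Fin q) (a : Fin p) (f : ℂ[X]) :
    (ν b a).Integrable (fun z => f.eval z) := by
  simp only [Polynomial.eval_eq_sum_range]
  exact integrable_finsetSum _ fun i _ => (h b a i).const_mul _

/-- Integration of polynomials against an entry of a matrix of measures with moments. -/
noncomputable def HasMoments.integralPoly (h : HasMoments ν) (b : Fin q) (a : Fin p) :
    ℂ[X] →ₗ[ℂ] ℂ where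
  toFun f := cint (ν b a) (fun z => f.eval z)
  map_add' f g := by
    simp only [eval_add]
    exact cint_add (h.integrable_eval b a f) (h.integrable_eval b a g)
  map_smul' c f := by
    simp only [eval_smul, smul_eq_mul, RingHom.id_apply]
    exact cint_const_mul c

lemma HasMoments.integralPoly_apply (h : HasMoments ν) (b : Fin q) (a : Fin p) (f : ℂ[X]) :
    h.integralPoly b a f = cint (ν b a) (fun z => f.eval z) := rfl

end Moments

/-! ### Measures on the line viewed in ℂ, and the distance to their support. -/

section RealLine

variable {q p : ℕ} (μ : Fin q → Fin p → ComplexMeasure ℝ)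

lemma isClosed_matSupport : IsClosed (matSupport μ) :=
  isClosed_iUnion_of_finite fun _ => isClosed_iUnion_of_finite fun _ => Measure.isClosed_support

lemma ae_lift_mem_matSupport (b : Fin q) (a : Fin p) :
    ∀ᵐ z ∂(lift μ b a).variation, ∃ t ∈ matSupport μ, z = (t : ℂ) := by
  refine (Measure.absolutelyContinuous_of_le VectorMeasure.variation_map_le).ae_le ?_
  refine (MeasurableEmbedding.ae_map_iff
    Complex.isometry_ofReal.isClosedEmbedding.measurableEmbedding).2 ?_
  filter_upwards [Measure.support_mem_ae (μ := (μ b a).variation)] with t ht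
  exact ⟨t, Set.mem_iUnion₂.2 ⟨b, a, ht⟩, rfl⟩

/-- The support is a finite union of closed sets, hence closed in ℂ, so a point off it has a whole
ball off it. -/
lemma exists_norm_inv_sub_le {x : ℂ} (hx : ∀ t ∈ matSupport μ, x ≠ (t : ℂ)) :
    ∃ K : ℝ, ∀ t ∈ matSupport μ, ‖((t : ℂ) - x)⁻¹‖ ≤ K := by
  have hc : IsClosed ((fun t : ℝ => (t : ℂ)) '' matSupport μ) :=
    Complex.isometry_ofReal.isClosedEmbedding.isClosedMap _ (isClosed_matSupport μ)
  have hm : x ∈ ((fun t : ℝ => (t : ℂ)) '' matSupport μ)ᶜ := by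
    rintro ⟨t, ht, rfl⟩
    exact hx t ht rfl
  obtain ⟨ε, hε, hB⟩ := Metric.isOpen_iff.1 hc.isOpen_compl x hm
  refine ⟨ε⁻¹, fun t ht => ?_⟩
  rw [norm_inv]
  refine inv_anti₀ hε (le_of_not_gt fun hlt => ?_)
  exact hB (by simpa [dist_eq_norm] using hlt : (t : ℂ) ∈ Metric.ball x ε) ⟨t, ht, rfl⟩

end RealLine

/-! ### Index degree of vector polynomials. -/

section IndexDegree

variable {r : ℕ} [NeZero r]

/-- The coefficient of a vector polynomial at the `j`-th vector monomial. -/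
noncomputable def idxCoeff (r : ℕ) [NeZero r] (j : ℕ) : (Fin r → ℂ[X]) →ₗ[ℂ] ℂ :=
  lcoeff ℂ (j / r) ∘ₗ LinearMap.proj (Fin.ofNat r j)

lemma idxCoeff_apply (j : ℕ) (u : Fin r → ℂ[X]) :
    idxCoeff r j u = (u (Fin.ofNat r j)).coeff (j / r) := rfl

lemma idxCoeff_mul_add (k : ℕ) (b : Fin r) (u : Fin r → ℂ[X]) :
    idxCoeff r (r * k + b) u = (u b).coeff k := by
  have h1 : Fin.ofNat r (r * k + b) = b := by
    ext
    simp [Fin.ofNat, Nat.mod_eq_of_lt b.isLt]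
  have h2 : (r * k + b) / r = k := by
    rw [Nat.mul_add_div (NeZero.pos r), Nat.div_eq_of_lt b.isLt, add_zero]
  rw [idxCoeff_apply, h1, h2]

lemma eq_zero_of_idxCoeff {u : Fin r → ℂ[X]} (h : ∀ j, idxCoeff r j u = 0) : u = 0 := by
  ext b k
  rw [← idxCoeff_mul_add, h]
  simp

lemma idxCoeff_monom (j k : ℕ) : idxCoeff r k (monom r j) = if k = j then 1 else 0 := by
  rw [idxCoeff_apply, monom]
  have key : k = j ↔ Fin.ofNat r j = Fin.ofNat r k ∧ k / r = j / r := by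
    refine ⟨fun h => by simp [h], fun ⟨h1, h2⟩ => ?_⟩
    have h3 : j % r = k % r := congrArg Fin.val h1
    rw [← Nat.div_add_mod k r, ← Nat.div_add_mod j r, h2, h3]
  by_cases h1 : Fin.ofNat r j = Fin.ofNat r k
  · rw [if_pos h1, coeff_X_pow]
    exact if_congr (by rw [key]; tauto) rfl rfl
  · rw [if_neg h1, coeff_zero, if_neg fun h => h1 (key.1 h).1]

/-- Vector polynomials all of whose vector monomials have index less than `n`. -/
noncomputable def lowDeg (r : ℕ) [NeZero r] (n : ℕ) : Submodule ℂ (Fin r → ℂ[X]) :=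
  ⨅ j ∈ Set.Ici n, LinearMap.ker (idxCoeff r j)

lemma mem_lowDeg {n : ℕ} {u : Fin r → ℂ[X]} :
    u ∈ lowDeg r n ↔ ∀ j, n ≤ j → idxCoeff r j u = 0 := by
  simp [lowDeg]

lemma mem_lowDeg' {n : ℕ} {u : Fin r → ℂ[X]} :
    u ∈ lowDeg r n ↔ ∀ (b : Fin r) (k : ℕ), n ≤ r * k + b → (u b).coeff k = 0 := by
  rw [mem_lowDeg]
  refine ⟨fun h b k hk => idxCoeff_mul_add k b u ▸ h _ hk, fun h j hj => ?_⟩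
  exact h _ _ (by simpa [Fin.ofNat, Nat.div_add_mod] using hj)

lemma lowDeg_mono {m n : ℕ} (h : m ≤ n) : lowDeg r m ≤ lowDeg r n := fun _ hu =>
  mem_lowDeg.2 fun j hj => mem_lowDeg.1 hu j (h.trans hj)

lemma mem_lowDeg_of_succ {n : ℕ} {u : Fin r → ℂ[X]} (hu : u ∈ lowDeg r (n + 1))
    (h : idxCoeff r n u = 0) : u ∈ lowDeg r n :=
  mem_lowDeg.2 fun j hj => (Nat.eq_or_lt_of_le hj).elim (fun e => e ▸ h) (mem_lowDeg.1 hu j)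

lemma monom_mem_lowDeg (n : ℕ) : monom r n ∈ lowDeg r (n + 1) :=
  mem_lowDeg.2 fun j hj => by rw [idxCoeff_monom, if_neg (by omega)]

lemma mem_lowDeg_zero {u : Fin r → ℂ[X]} (hu : u ∈ lowDeg r 0) : u = 0 :=
  eq_zero_of_idxCoeff fun j => mem_lowDeg.1 hu j j.zero_le

lemma exists_idxCoeff_ne_zero {u : Fin r → ℂ[X]} (hu : u ≠ 0) :
    ∃ n, u ∈ lowDeg r (n + 1) ∧ idxCoeff r n u ≠ 0 := by
  have hex : ∃ n, u ∈ lowDeg r n := by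
    refine ⟨r * (Finset.univ.sup (fun b => (u b).natDegree) + 1), mem_lowDeg'.2 fun b k hk => ?_⟩
    refine coeff_eq_zero_of_natDegree_lt ?_
    have h1 : (u b).natDegree ≤ Finset.univ.sup (fun b => (u b).natDegree) :=
      Finset.le_sup (f := fun b => (u b).natDegree) (Finset.mem_univ b)
    have h2 := b.isLt
    by_contra hlt
    have : r * k ≤ r * Finset.univ.sup (fun b => (u b).natDegree) :=
      Nat.mul_le_mul_left r (by omega)
    rw [mul_add] at hk
    omega
  classical
  have hmin := Nat.find_spec hex
  rcases hn : Nat.find hex with _ | n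
  · exact absurd (mem_lowDeg_zero (hn ▸ hmin)) hu
  · rw [hn] at hmin
    refine ⟨n, hmin, fun h0 => ?_⟩
    exact Nat.find_min hex (m := n) (by omega) (mem_lowDeg_of_succ hmin h0)

/-- A linear functional vanishing on low index degrees and on one vector polynomial of every
further index degree vanishes. -/
lemma eq_zero_on_lowDeg (φ : (Fin r → ℂ[X]) →ₗ[ℂ] ℂ) (P : ℕ → Fin r → ℂ[X]) {m n : ℕ}
    (hmem : ∀ k, m ≤ k → k < n → P k ∈ lowDeg r (k + 1))
    (hlead : ∀ k, m ≤ k → k < n → idxCoeff r k (P k) ≠ 0)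
    (hm : ∀ u ∈ lowDeg r m, φ u = 0) (hφ : ∀ k, m ≤ k → k < n → φ (P k) = 0) :
    ∀ u ∈ lowDeg r n, φ u = 0 := by
  induction n with
  | zero => exact fun u hu => hm u (lowDeg_mono m.zero_le hu)
  | succ n ih =>
    intro u hu
    rcases Nat.lt_or_ge n m with h | h
    · exact hm u (lowDeg_mono h hu)
    have hl := hlead n h n.lt_succ_self
    set c := idxCoeff r n u / idxCoeff r n (P n)
    have h1 : u - c • P n ∈ lowDeg r n := by
      refine mem_lowDeg_of_succ (sub_mem hu (Submodule.smul_mem _ _ (hmem n h n.lt_succ_self))) ?_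
      simp [c, hl]
    have h2 := ih (fun k hk hk' => hmem k hk (by omega)) (fun k hk hk' => hlead k hk (by omega))
      (fun k hk hk' => hφ k hk (by omega)) _ h1
    rw [map_sub, map_smul, hφ n h n.lt_succ_self, smul_zero, sub_zero] at h2
    exact h2

/-- The coefficient map, injective on vector polynomials of index degree less than `n`. -/
noncomputable def lowDegCoeff (r : ℕ) [NeZero r] (n : ℕ) : lowDeg r n →ₗ[ℂ] (Fin n → ℂ) :=
  LinearMap.pi fun j : Fin n => idxCoeff r j ∘ₗ (lowDeg r n).subtype

lemma lowDegCoeff_injective (n : ℕ) : Function.Injective (lowDegCoeff r n) := by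
  rw [← LinearMap.ker_eq_bot, LinearMap.ker_eq_bot']
  intro u hu
  refine Subtype.ext (eq_zero_of_idxCoeff fun j => ?_)
  rcases Nat.lt_or_ge j n with h | h
  · exact congrFun hu ⟨j, h⟩
  · exact mem_lowDeg.1 u.2 j h

instance (n : ℕ) : Module.Finite ℂ (lowDeg r n) :=
  Module.Finite.of_injective (lowDegCoeff r n) (lowDegCoeff_injective n)

lemma finrank_lowDeg_le (n : ℕ) : Module.finrank ℂ (lowDeg r n) ≤ n := by
  simpa using LinearMap.finrank_le_finrank_of_injective (lowDegCoeff_injective (r := r) n)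

/-- The space has dimension at most M, so M independent elements span it. -/
lemma eq_zero_on_lowDeg_of_linearIndependent {M : ℕ} {R : Fin M → Fin r → ℂ[X]}
    (hR : LinearIndependent ℂ R) (hmem : ∀ i, R i ∈ lowDeg r M) (φ : (Fin r → ℂ[X]) →ₗ[ℂ] ℂ)
    (hφ : ∀ i, φ (R i) = 0) : ∀ u ∈ lowDeg r M, φ u = 0 := by
  have h : LinearIndependent ℂ (fun i => (⟨R i, hmem i⟩ : lowDeg r M)) :=
    LinearIndependent.of_comp (lowDeg r M).subtype hR
  have hspan := h.span_eq_top_of_card_eq_finrank'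
    (le_antisymm h.fintype_card_le_finrank (by simpa using finrank_lowDeg_le (r := r) M))
  intro u hu
  have hle : Submodule.span ℂ (Set.range fun i => (⟨R i, hmem i⟩ : lowDeg r M)) ≤
      LinearMap.ker (φ ∘ₗ (lowDeg r M).subtype) := by
    rw [Submodule.span_le]
    rintro _ ⟨i, rfl⟩
    exact hφ i
  exact hle (hspan ▸ Submodule.mem_top : (⟨u, hu⟩ : lowDeg r M) ∈ _)

end IndexDegree

/-! ### Biorthogonal families and nondegeneracy. -/

section Biorthogonality

variable {q p : ℕ} [NeZero q] [NeZero p]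

/-- Biorthogonal families of vector polynomials with respect to a bilinear form. -/
structure Biorthogonal (β : (Fin q → ℂ[X]) →ₗ[ℂ] (Fin p → ℂ[X]) →ₗ[ℂ] ℂ)
    (B : ℕ → Fin q → ℂ[X]) (A : ℕ → Fin p → ℂ[X]) : Prop where
  left_mem : ∀ n, B n ∈ lowDeg q (n + 1)
  left_lead : ∀ n, idxCoeff q n (B n) ≠ 0
  right_mem : ∀ n, A n ∈ lowDeg p (n + 1)
  right_lead : ∀ n, idxCoeff p n (A n) ≠ 0
  orth : ∀ i j, β (B i) (A j) = if i = j then 1 else 0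

namespace Biorthogonal

variable {β : (Fin q → ℂ[X]) →ₗ[ℂ] (Fin p → ℂ[X]) →ₗ[ℂ] ℂ}
  {B : ℕ → Fin q → ℂ[X]} {A : ℕ → Fin p → ℂ[X]}

lemma flip (h : Biorthogonal β B A) : Biorthogonal β.flip A B where
  left_mem := h.right_mem
  left_lead := h.right_lead
  right_mem := h.left_mem
  right_lead := h.left_lead
  orth i j := by simp [h.orth, eq_comm]

lemma left_apply_eq_zero (h : Biorthogonal β B A) (n : ℕ) :
    ∀ w ∈ lowDeg p n, β (B n) w = 0 :=
  eq_zero_on_lowDeg (m := 0) (β (B n)) A (fun k _ _ => h.right_mem k) (fun k _ _ => h.right_lead k)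
    (fun u hu => by rw [mem_lowDeg_zero hu, map_zero])
    fun k _ hk => by rw [h.orth, if_neg (by omega)]

/-- Nondegeneracy of the form on each truncation: pairing with the top `B n` reads off the leading
coefficient of w in terms of `A n`, which must vanish, and the index degree drops. -/
lemma right_eq_zero (h : Biorthogonal β B A) (n : ℕ) :
    ∀ w ∈ lowDeg p n, (∀ u ∈ lowDeg q n, β u w = 0) → w = 0 := by
  induction n with
  | zero => exact fun w hw _ => mem_lowDeg_zero hw
  | succ n ih =>
    intro w hw hort
    refine ih w (mem_lowDeg_of_succ hw ?_) fun u hu => hort u (lowDeg_mono n.le_succ hu)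
    have hl := h.right_lead n
    set c := idxCoeff p n w / idxCoeff p n (A n) with hc
    have h1 : w - c • A n ∈ lowDeg p n := by
      refine mem_lowDeg_of_succ (sub_mem hw (Submodule.smul_mem _ _ (h.right_mem n))) ?_
      simp [c, hl]
    have h2 := h.left_apply_eq_zero n _ h1
    rw [map_sub, map_smul, hort _ (h.left_mem n), h.orth, if_pos rfl] at h2
    have h3 : c = 0 := by simpa using h2
    simpa [hc, hl] using h3

lemma left_eq_zero (h : Biorthogonal β B A) (n : ℕ) :
    ∀ u ∈ lowDeg q n, (∀ w ∈ lowDeg p n, β u w = 0) → u = 0 :=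
  h.flip.right_eq_zero n

end Biorthogonal

end Biorthogonality

/-! ### Determinants as linear functions of one row or column. -/

section Determinants

/-- A determinant as a function of its last column. -/
lemma exists_det_lastCol {M : ℕ} (hM : 1 ≤ M) (X : Fin M → Fin M → ℂ) :
    ∃ d : (Fin M → ℂ) →ₗ[ℂ] ℂ, ∀ ρ : Fin M → ℂ,
      Matrix.det (Matrix.of fun i j : Fin M => if (j : ℕ) + 1 < M then X i j else ρ i) = d ρ := by
  let l : Fin M := ⟨M - 1, by omega⟩
  refine ⟨LinearMap.proj l ∘ₗ (Matrix.cramer (Matrix.of X)), fun ρ => ?_⟩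
  rw [LinearMap.comp_apply, LinearMap.proj_apply, Matrix.cramer_apply]
  congr 1
  ext i j
  rw [Matrix.updateCol_apply, Matrix.of_apply, Matrix.of_apply]
  have : j = l ↔ ¬ (j : ℕ) + 1 < M := by
    simp only [l, Fin.ext_iff]
    omega
  by_cases h : (j : ℕ) + 1 < M <;> simp [h, this]

/-- A determinant as a function of its last row, with the cofactor of the last entry. -/
lemma exists_det_lastRow {M : ℕ} (X : Fin M → Fin (M + 1) → ℂ) :
    ∃ c : Fin (M + 1) → ℂ, c (Fin.last M) = Matrix.det (Matrix.of fun i j => X i j.castSucc) ∧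
      ∀ ρ : Fin (M + 1) → ℂ,
      Matrix.det (Matrix.of fun i j : Fin (M + 1) => if h : (i : ℕ) < M then X ⟨i, h⟩ j else ρ j) =
        ∑ j, c j * ρ j := by
  refine ⟨fun j => (-1) ^ (M + (j : ℕ)) *
    Matrix.det (Matrix.of fun i k : Fin M => X i (j.succAbove k)), ?_, fun ρ => ?_⟩
  · simp [← two_mul]
  · rw [Matrix.det_succ_row _ (Fin.last M)]
    refine Finset.sum_congr rfl fun j _ => ?_
    have : (Matrix.of fun i j : Fin (M + 1) =>
        if h : (i : ℕ) < M then X ⟨i, h⟩ j else ρ j).submatrix (Fin.last M).succAbove j.succAbove = Matrix.of fun i k : Fin M => X i (j.succAbove k) := by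
      ext i k
      simp
    rw [this]
    simp
    ring

end Determinants

/-! ### The determinantal formulas for abstract bilinear forms. -/

section Christoffel

variable {q p M : ℕ} [NeZero q] [NeZero p]
  {β β' : (Fin q → ℂ[X]) →ₗ[ℂ] (Fin p → ℂ[X]) →ₗ[ℂ] ℂ}
  {B B' : ℕ → Fin q → ℂ[X]} {A A' : ℕ → Fin p → ℂ[X]}
  {Λ : (Fin q → ℂ[X]) →ₗ[ℂ] (Fin q → ℂ[X])} {R : Fin M → Fin q → ℂ[X]} {E : ℕ → Fin M → ℂ}

/-- The algebraic content of a left Geronimus perturbation: biorthogonal families for two bilinear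
forms related by an operator `Λ` raising the index degree by `M`, together with a basis `R` of the
vector polynomials of index degree less than `M`. -/
structure GeronimusData (β β' : (Fin q → ℂ[X]) →ₗ[ℂ] (Fin p → ℂ[X]) →ₗ[ℂ] ℂ)
    (B B' : ℕ → Fin q → ℂ[X]) (A A' : ℕ → Fin p → ℂ[X])
    (Λ : (Fin q → ℂ[X]) →ₗ[ℂ] (Fin q → ℂ[X])) (R : Fin M → Fin q → ℂ[X])
    (E : ℕ → Fin M → ℂ) : Prop where
  orth : Biorthogonal β B A
  orth' : Biorthogonal β' B' A'
  monic : ∀ n, idxCoeff p n (A n) = 1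
  monic' : ∀ n, idxCoeff p n (A' n) = 1
  perturb : ∀ u w, β' (Λ u) w = β u w
  raise_mem : ∀ n, ∀ u ∈ lowDeg q n, Λ u ∈ lowDeg q (n + M)
  raise_lead : ∀ n, ∀ u ∈ lowDeg q (n + 1), idxCoeff q (n + M) (Λ u) = idxCoeff q n u
  indep : LinearIndependent ℂ R
  low : ∀ i, R i ∈ lowDeg q M
  coeff : ∀ n i, E n i = -β' (R i) (A n)

namespace GeronimusData

/-- Index degrees below M are covered by the basis `R`, and each index k with M ≤ k < m + M by `Λ (B
(k - M))`, whose β'-pairing is a β-pairing. -/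
lemma left_orth (G : GeronimusData β β' B B' A A' Λ R E) (m : ℕ) {w : Fin p → ℂ[X]}
    (hR : ∀ i, β' (R i) w = 0) (hB : ∀ k < m, β (B k) w = 0) :
    ∀ u ∈ lowDeg q (m + M), β' u w = 0 := by
  refine eq_zero_on_lowDeg (m := M) (β'.flip w) (fun k => Λ (B (k - M))) (fun k hk _ => ?_)
    (fun k hk _ => ?_) (eq_zero_on_lowDeg_of_linearIndependent G.indep G.low (β'.flip w) hR)
    fun k hk hk' => ?_
  · have := G.raise_mem _ _ (G.orth.left_mem (k - M))
    rwa [show k - M + 1 + M = k + 1 by omega] at this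
  · have := G.raise_lead _ _ (G.orth.left_mem (k - M))
    rw [show k - M + M = k by omega] at this
    rw [this]
    exact G.orth.left_lead _
  · rw [LinearMap.flip_apply, G.perturb, hB _ (by omega)]

lemma sum_mem (G : GeronimusData β β' B B' A A' Λ R E) (m n : ℕ) {k : ℕ} (hk : m + k ≤ n)
    (c : Fin k → ℂ) : ∑ j, c j • A (m + j) ∈ lowDeg p n :=
  Submodule.sum_mem _ fun j _ => Submodule.smul_mem _ _
    (lowDeg_mono (by have := j.isLt; omega) (G.orth.right_mem (m + j)))

lemma pair_sum (G : GeronimusData β β' B B' A A' Λ R E) (m : ℕ) {k : ℕ} (c : Fin k → ℂ)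
    (i : Fin M) : β' (R i) (∑ j, c j • A (m + j)) = -∑ j, c j * E (m + j) i := by
  simp [G.coeff]

lemma left_pair_sum (G : GeronimusData β β' B B' A A' Λ R E) (m : ℕ) {k l : ℕ} (hl : l < m)
    (c : Fin k → ℂ) : β (B l) (∑ j, c j • A (m + j)) = 0 := by
  rw [map_sum]
  refine Finset.sum_eq_zero fun j _ => ?_
  rw [map_smul, G.orth.orth, if_neg (by omega), smul_zero]

/-- A null vector c makes ∑ c_j A_{m+j}, of index less than m + M, orthogonal to every row of index
less than m + M. Nondegeneracy of β' makes it zero, and pairing with the `B (m + j)` gives c = 0. -/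
lemma det_ne_zero (G : GeronimusData β β' B B' A A' Λ R E) (m : ℕ) :
    Matrix.det (Matrix.of fun i j : Fin M => E (m + j) i) ≠ 0 := by
  intro hdet
  obtain ⟨c, hc, h0⟩ := Matrix.exists_mulVec_eq_zero_iff.2 hdet
  refine hc ?_
  have hw : ∑ j, c j • A (m + j) = 0 := by
    refine G.orth'.right_eq_zero (m + M) _ (G.sum_mem m _ le_rfl c) (G.left_orth m (fun i => ?_)
      fun k hk => G.left_pair_sum m hk c)
    rw [G.pair_sum, neg_eq_zero]
    simpa [Matrix.mulVec, dotProduct, mul_comm] using congrFun h0 i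
  ext j
  have h1 := congrArg (β (B (m + j))) hw
  simpa [G.orth.orth, Fin.val_inj] using h1

lemma det_right (G : GeronimusData β β' B B' A A' Λ R E) (m : ℕ)
    (φ : (Fin p → ℂ[X]) →ₗ[ℂ] ℂ) :
    Matrix.det (Matrix.of fun i j : Fin (M + 1) =>
      if h : (i : ℕ) < M then E (m + j) ⟨i, h⟩ else φ (A (m + j))) =
    Matrix.det (Matrix.of fun i j : Fin M => E (m + j) i) * φ (A' (m + M)) := by
  obtain ⟨c, hlast, hc⟩ := exists_det_lastRow fun (i : Fin M) (j : Fin (M + 1)) => E (m + j) i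
  simp only [Fin.val_castSucc] at hlast
  rw [hc fun j => φ (A (m + j)), ← hlast]
  set w := ∑ j, c j • A (m + j) with hw
  -- Both terms have the same leading coefficient, as the families are monic, and both are
  -- orthogonal to all rows of index less than m + M.
  have hmain : w - c (Fin.last M) • A' (m + M) = 0 := by
    refine G.orth'.right_eq_zero (m + M) _ ?_ fun u hu => ?_
    · refine mem_lowDeg_of_succ (sub_mem (G.sum_mem m _ (by omega) c)
        (Submodule.smul_mem _ _ (G.orth'.right_mem _))) ?_
      rw [map_sub, map_smul, G.monic', hw, Fin.sum_univ_castSucc, map_add, map_smul, Fin.val_last,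
        G.monic]
      simp only [Fin.val_castSucc]
      rw [mem_lowDeg.1 (G.sum_mem m (m + M) le_rfl fun j => c j.castSucc) _ le_rfl]
      simp
    · rw [map_sub, map_smul]
      have h2 : β' u (A' (m + M)) = 0 := G.orth'.flip.left_apply_eq_zero (m + M) u hu
      rw [h2, smul_zero, sub_zero]
      refine G.left_orth m (fun i => ?_) (fun k hk => G.left_pair_sum m hk c) u hu
      rw [G.pair_sum, ← hc fun j => E (m + j) i, neg_eq_zero]
      -- Pairing with `R i` replaces the last row of the bordered determinant by a copy of row i.
      refine Matrix.det_zero_of_row_eq (i := i.castSucc) (j := Fin.last M)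
        i.castSucc_lt_last.ne ?_
      ext j
      simp
  have h3 := congrArg φ (sub_eq_zero.1 hmain)
  rw [map_smul, smul_eq_mul] at h3
  rw [← h3, hw, map_sum]
  simp

lemma det_left (G : GeronimusData β β' B B' A A' Λ R E) (hM : 1 ≤ M) (m : ℕ)
    (φ : (Fin q → ℂ[X]) →ₗ[ℂ] ℂ) :
    Matrix.det (Matrix.of fun i j : Fin M => if (j : ℕ) + 1 < M then E (m + 1 + j) i else
      φ (R i + ∑ k ∈ Finset.range (m + 1), E k i • Λ (B k))) =
    -(Matrix.det (Matrix.of fun i j : Fin M => E (m + 1 + j) i) * φ (B' (m + M))) := by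
  obtain ⟨d, hd⟩ := exists_det_lastCol hM fun i j : Fin M => E (m + 1 + j) i
  set Z := fun i => R i + ∑ k ∈ Finset.range (m + 1), E k i • Λ (B k) with hZ
  set τ := Matrix.det (Matrix.of fun i j : Fin M => E (m + 1 + j) i)
  -- The numbers `d (Pi.single i 1)` are the cofactors of the last column, used next as the
  -- coefficients of `P`.
  have hds (ρ : Fin M → ℂ) : d ρ = ∑ i, ρ i * d (Pi.single i 1) := by
    rw [LinearMap.pi_apply_eq_sum_univ d ρ]
    refine Finset.sum_congr rfl fun i _ => ?_
    rw [smul_eq_mul]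
    congr 2
    ext j
    simp [Pi.single_apply, eq_comm]
  set P := ∑ i, d (Pi.single i 1) • Z i with hP
  have hφ (ψ : (Fin q → ℂ[X]) →ₗ[ℂ] ℂ) : ψ P = d fun i => ψ (Z i) := by
    rw [hds, hP, map_sum]
    simp [mul_comm]
  have hZmem (i : Fin M) : Z i ∈ lowDeg q (m + M + 1) := by
    refine add_mem (lowDeg_mono (by omega) (G.low i)) (Submodule.sum_mem _ fun k hk => ?_)
    refine Submodule.smul_mem _ _ (lowDeg_mono ?_ (G.raise_mem _ _ (G.orth.left_mem k)))
    have := Finset.mem_range.1 hk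
    omega
  -- The correction terms in `Z i` contribute E_j^(i) exactly for j ≤ m, cancelling the pairing of
  -- `R i`.
  have hZA (i : Fin M) (j : ℕ) : β' (Z i) (A j) = if j ≤ m then 0 else -E j i := by
    simp only [hZ, map_add, map_sum, map_smul, LinearMap.add_apply, LinearMap.sum_apply,
      LinearMap.smul_apply, G.perturb, G.orth.orth, smul_eq_mul, mul_ite, mul_one, mul_zero,
      Finset.sum_ite_eq', Finset.mem_range]
    rw [show β' (R i) (A j) = -E j i by rw [G.coeff, neg_neg]]
    by_cases h : j ≤ m
    · simp [h, Nat.lt_succ_of_le h]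
    · simp [h, show ¬ j < m + 1 by omega]
  -- For these j the last column repeats an earlier one; at j = m + M it completes the matrix of τ
  -- instead, which is `hd2`.
  have hd1 (j : ℕ) (hj : m < j) (hj' : j < m + M) : d (fun i => -E j i) = 0 := by
    rw [show (fun i => -E j i) = -fun i => E j i from rfl, map_neg, ← hd, neg_eq_zero]
    refine Matrix.det_zero_of_column_eq (i := ⟨j - m - 1, by omega⟩) (j := ⟨M - 1, by omega⟩)
      (by simp; omega) fun i => ?_
    simp [show j - m - 1 + 1 < M by omega, show ¬ M - 1 + 1 < M by omega,
      show m + 1 + (j - m - 1) = j by omega]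
  have hd2 : d (fun i => -E (m + M) i) = -τ := by
    rw [show (fun i => -E (m + M) i) = -fun i => E (m + M) i from rfl, map_neg, ← hd]
    congr 2
    ext i j
    rw [Matrix.of_apply, Matrix.of_apply]
    split_ifs with h
    · rfl
    · rw [show m + M = m + 1 + j by have := j.isLt; omega]
  have hmain : P + τ • B' (m + M) = 0 := by
    refine G.orth'.left_eq_zero (m + M + 1) _ ?_ ?_
    · exact add_mem (Submodule.sum_mem _ fun i _ => Submodule.smul_mem _ _ (hZmem i))
        (Submodule.smul_mem _ _ (G.orth'.left_mem _))
    refine eq_zero_on_lowDeg (m := 0) (β' _) A (fun k _ _ => G.orth.right_mem k)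
      (fun k _ _ => G.orth.right_lead k) (fun u hu => by rw [mem_lowDeg_zero hu, map_zero])
      fun j _ hj => ?_
    rw [map_add, map_smul, LinearMap.add_apply, LinearMap.smul_apply,
      show β' P (A j) = d fun i => β' (Z i) (A j) from hφ (β'.flip (A j))]
    simp only [hZA]
    rcases Nat.lt_or_ge j (m + M) with h | h
    · have h0 : β' (B' (m + M)) (A j) = 0 :=
        G.orth'.left_apply_eq_zero _ _ (lowDeg_mono h (G.orth.right_mem j))
      rw [h0, smul_zero, add_zero]
      by_cases hjm : j ≤ m
      · simp only [hjm, if_true]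
        exact map_zero d
      · simp only [hjm, if_false]
        exact hd1 j (by omega) h
    · obtain rfl : j = m + M := by omega
      -- The difference of two monic elements has lower index degree, so `B' (m + M)` pairs to 1
      -- with `A (m + M)` as well.
      have h0 : β' (B' (m + M)) (A (m + M) - A' (m + M)) = 0 := by
        refine G.orth'.left_apply_eq_zero _ _ (mem_lowDeg_of_succ
          (sub_mem (G.orth.right_mem _) (G.orth'.right_mem _)) ?_)
        rw [map_sub, G.monic, G.monic', sub_self]
      rw [map_sub, G.orth'.orth, if_pos rfl, sub_eq_zero] at h0
      simp only [show ¬ m + M ≤ m by omega, if_false]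
      rw [hd2, h0]
      simp
  have h3 := congrArg φ (eq_neg_of_add_eq_zero_left hmain)
  rw [hφ, map_neg, map_smul, smul_eq_mul, ← hd] at h3
  exact h3

end GeronimusData

end Christoffel

/-! ### The operator u ↦ uL and its effect on the index degree. -/

section LeftMultiplication

variable {q : ℕ} {L : Matrix (Fin q) (Fin q) ℂ[X]} {N r M : ℕ}

/-- Multiplication `u ↦ u L` of row vector polynomials by a matrix polynomial. -/
noncomputable def mulRight (L : Matrix (Fin q) (Fin q) ℂ[X]) :
    (Fin q → ℂ[X]) →ₗ[ℂ] (Fin q → ℂ[X]) :=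
  (Matrix.vecMulLinear L).restrictScalars ℂ

lemma mulRight_apply (L : Matrix (Fin q) (Fin q) ℂ[X]) (u : Fin q → ℂ[X]) (b : Fin q) :
    mulRight L u b = ∑ c, u c * L c b := rfl

lemma mulRight_mul (L : Matrix (Fin q) (Fin q) ℂ[X]) (f : ℂ[X]) (u : Fin q → ℂ[X]) :
    mulRight L (f • u) = f • mulRight L u :=
  (Matrix.vecMulLinear L).map_smul f u

/-- This recasts the two block conditions in terms of indices. As M = Nq - r, the index c + M sits
in degree N at position c - r when c ≥ r, and in degree N - 1 at position c + q - r when c < r. -/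
lemma IsNormalized.coeff_eq (hL : IsNormalized L N r) (hN : 1 ≤ N) (hr : r < q)
    (hM : M + r = N * q) (c b : Fin q) (j : ℕ) (h : (c : ℕ) + M ≤ q * j + b) :
    (L c b).coeff j = if q * j + (b : ℕ) = c + M then 1 else 0 := by
  have hb := b.isLt
  have hc := c.isLt
  obtain ⟨N, rfl⟩ : ∃ k, N = k + 1 := ⟨N - 1, by omega⟩
  rw [add_mul, one_mul, mul_comm] at hM
  rcases lt_trichotomy j (N + 1) with hj | rfl | hj
  · have hjN : j = N := by
      by_contra hne
      have : q * (j + 1) ≤ q * N := Nat.mul_le_mul_left q (by omega)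
      rw [mul_add] at this
      omega
    subst hjN
    rw [show j = j + 1 - 1 from rfl, hL.subleading c b (by omega) (by omega)]
    exact if_congr (by simp only [Nat.add_sub_cancel]; omega) rfl rfl
  · rw [hL.leading]
    rw [mul_add] at h ⊢
    exact if_congr (by omega) rfl rfl
  · rw [coeff_eq_zero_of_natDegree_lt ((hL.degree_le c b).trans_lt hj), if_neg]
    have : q * (N + 1 + 1) ≤ q * j := Nat.mul_le_mul_left q hj
    rw [mul_add, mul_add] at this
    omega

lemma eval_mulRight (L : Matrix (Fin q) (Fin q) ℂ[X]) (u : Fin q → ℂ[X]) (b : Fin q) (z : ℂ) :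
    (mulRight L u b).eval z = ∑ c, (u c).eval z * evalMat L z c b := by
  simp [mulRight_apply, eval_finsetSum, evalMat]

lemma det_evalMat (L : Matrix (Fin q) (Fin q) ℂ[X]) (z : ℂ) :
    (evalMat L z).det = L.det.eval z := by
  have := (RingHom.map_det (evalRingHom z) L).symm
  simpa [evalMat] using this

/-- A row vector of constant polynomials. -/
noncomputable def constRow (v : Fin q → ℂ) : Fin q → ℂ[X] := fun c => C (v c)

/-- The vector polynomial `v L(x) / (x - x₀)`, for a left null vector `v` of `L(x₀)`. -/
noncomputable def quotRow (L : Matrix (Fin q) (Fin q) ℂ[X]) (x₀ : ℂ) (v : Fin q → ℂ) :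
    Fin q → ℂ[X] :=
  fun b => mulRight L (constRow v) b /ₘ (X - C x₀)

lemma smul_quotRow {x₀ : ℂ} {v : Fin q → ℂ} (hv : Matrix.vecMul v (evalMat L x₀) = 0) :
    (X - C x₀) • quotRow L x₀ v = mulRight L (constRow v) := by
  ext1 b
  refine mul_divByMonic_eq_iff_isRoot.2 ?_
  rw [IsRoot.def, eval_mulRight]
  simpa [constRow, Matrix.vecMul, dotProduct] using congrFun hv b

variable [NeZero q]

lemma IsNormalized.mulRight_mem (hL : IsNormalized L N r) (hN : 1 ≤ N) (hr : r < q)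
    (hM : M + r = N * q) (n : ℕ) (u : Fin q → ℂ[X]) (hu : u ∈ lowDeg q n) :
    mulRight L u ∈ lowDeg q (n + M) := by
  refine mem_lowDeg'.2 fun b k hk => ?_
  rw [mulRight_apply, finsetSum_coeff]
  refine Finset.sum_eq_zero fun c _ => ?_
  rw [coeff_mul]
  refine Finset.sum_eq_zero fun ij hij => ?_
  obtain ⟨i, j⟩ := ij
  obtain rfl : i + j = k := Finset.HasAntidiagonal.mem_antidiagonal.1 hij
  rcases Nat.lt_or_ge (q * i + c) n with h | h
  · rw [mul_add] at hk
    rw [hL.coeff_eq hN hr hM c b j (by omega), if_neg (by omega), mul_zero]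
  · rw [mem_lowDeg'.1 hu c i h, zero_mul]

lemma IsNormalized.idxCoeff_mulRight (hL : IsNormalized L N r) (hN : 1 ≤ N) (hr : r < q)
    (hM : M + r = N * q) (n : ℕ) (u : Fin q → ℂ[X]) (hu : u ∈ lowDeg q (n + 1)) :
    idxCoeff q (n + M) (mulRight L u) = idxCoeff q n u := by
  have h1 : idxCoeff q (n + M) (mulRight L (monom q n)) = 1 := by
    set b := Fin.ofNat q (n + M)
    set k := (n + M) / q with hk
    have hkb : q * k + b = n + M := by simp [k, b, Nat.div_add_mod]
    have hc : q * (n / q) + (Fin.ofNat q n : Fin q) = n := by simp [Nat.div_add_mod]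
    have hle : n / q ≤ k := Nat.div_le_div_right (Nat.le_add_right n M)
    rw [← hkb, idxCoeff_mul_add, mulRight_apply, Finset.sum_eq_single (Fin.ofNat q n)]
    · rw [monom, if_pos rfl, coeff_X_pow_mul', if_pos hle]
      have : q * (k - n / q) + q * (n / q) = q * k := by rw [← mul_add, Nat.sub_add_cancel hle]
      rw [hL.coeff_eq hN hr hM _ b _ (by omega), if_pos (by omega)]
    · intro c _ hc
      rw [monom, if_neg hc.symm, zero_mul]
    · simp
  have h2 : u - idxCoeff q n u • monom q n ∈ lowDeg q n := by
    refine mem_lowDeg_of_succ (sub_mem hu (Submodule.smul_mem _ _ (monom_mem_lowDeg n))) ?_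
    simp [idxCoeff_monom]
  have h3 := mem_lowDeg.1 (hL.mulRight_mem hN hr hM n _ h2) _ le_rfl
  rw [map_sub, map_smul, map_sub, map_smul, h1, sub_eq_zero] at h3
  simpa using h3

lemma IsNormalized.mulRight_injective (hL : IsNormalized L N r) (hN : 1 ≤ N) (hr : r < q)
    (hM : M + r = N * q) : Function.Injective (mulRight L) := by
  rw [← LinearMap.ker_eq_bot, LinearMap.ker_eq_bot']
  intro u hu
  by_contra hne
  obtain ⟨n, hn, hn'⟩ := exists_idxCoeff_ne_zero hne
  rw [← hL.idxCoeff_mulRight hN hr hM n u hn, hu, map_zero] at hn'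
  exact hn' rfl

lemma IsNormalized.det_ne_zero (hL : IsNormalized L N r) (hN : 1 ≤ N) (hr : r < q)
    (hM : M + r = N * q) : L.det ≠ 0 := by
  intro h
  obtain ⟨u, hu, h0⟩ := Matrix.exists_vecMul_eq_zero_iff.2 h
  exact hu (hL.mulRight_injective hN hr hM (h0.trans (map_zero _).symm))

lemma constRow_mem (v : Fin q → ℂ) : constRow v ∈ lowDeg q q := by
  refine mem_lowDeg'.2 fun b k hk => ?_
  have : k ≠ 0 := by
    rintro rfl
    have := b.isLt
    omega
  rw [constRow, coeff_C, if_neg this]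

/-- Multiplication by x - x₀ raises the index degree by exactly q. -/
lemma mem_lowDeg_of_smul {m : ℕ} {x₀ : ℂ} {u : Fin q → ℂ[X]}
    (h : (X - C x₀) • u ∈ lowDeg q (m + q)) : u ∈ lowDeg q m := by
  rcases eq_or_ne u 0 with rfl | hu
  · exact zero_mem _
  obtain ⟨n, hn, hn'⟩ := exists_idxCoeff_ne_zero hu
  rcases Nat.lt_or_ge n m with hnm | hnm
  · exact lowDeg_mono hnm hn
  refine absurd ?_ hn'
  set b := Fin.ofNat q n
  set k := n / q
  have hkb : q * k + b = n := by simp [k, b, Nat.div_add_mod]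
  have h1 := mem_lowDeg'.1 h b (k + 1) (by rw [mul_add]; omega)
  have h2 := mem_lowDeg'.1 hn b (k + 1) (by rw [mul_add]; have := NeZero.pos q; omega)
  rw [Pi.smul_apply, smul_eq_mul, sub_mul, coeff_sub, coeff_X_mul, coeff_C_mul, h2, mul_zero,
    sub_zero] at h1
  exact h1

/-- A constant row has index less than q; L adds M and the division by x - x₀ removes q. -/
lemma IsNormalized.quotRow_mem (hL : IsNormalized L N r) (hN : 1 ≤ N) (hr : r < q)
    (hM : M + r = N * q) {x₀ : ℂ} {v : Fin q → ℂ} (hv : Matrix.vecMul v (evalMat L x₀) = 0) :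
    quotRow L x₀ v ∈ lowDeg q M := by
  refine mem_lowDeg_of_smul (x₀ := x₀) ?_
  rw [smul_quotRow hv, add_comm]
  exact hL.mulRight_mem hN hr hM q _ (constRow_mem v)

end LeftMultiplication

/-! ### The basis attached to the eigenvectors, and the kernels of L(x_i). -/

section Eigenvalues

variable {q : ℕ} {L : Matrix (Fin q) (Fin q) ℂ[X]} {N r M : ℕ}

/-- The polynomial `∏_{j ≠ i} (x - x_j)`. -/
noncomputable def nodalErase (D : EigenData L M) (i : Fin M) : ℂ[X] :=
  ∏ j ∈ Finset.univ.erase i, (X - C (D.x j))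

lemma mul_nodalErase (D : EigenData L M) (i : Fin M) :
    (X - C (D.x i)) * nodalErase D i = ∏ j, (X - C (D.x j)) :=
  Finset.mul_prod_erase Finset.univ (fun j => X - C (D.x j)) (Finset.mem_univ i)

lemma eval_nodalErase_self (D : EigenData L M) (i : Fin M) :
    (nodalErase D i).eval (D.x i) ≠ 0 := by
  rw [nodalErase, eval_prod, Finset.prod_ne_zero_iff]
  intro j hj
  simpa [sub_eq_zero] using fun h => (Finset.ne_of_mem_erase hj) (D.x_injective h).symm

lemma eval_nodalErase_of_ne (D : EigenData L M) {i j : Fin M} (h : i ≠ j) :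
    (nodalErase D i).eval (D.x j) = 0 := by
  rw [nodalErase, eval_prod]
  exact Finset.prod_eq_zero (Finset.mem_erase.2 ⟨h.symm, Finset.mem_univ j⟩) (by simp)

lemma eval_sum_nodalErase (D : EigenData L M) (α : Fin M → ℂ) (i : Fin M) (c : Fin q) :
    ((∑ j, α j • nodalErase D j • constRow (D.vL j)) c).eval (D.x i) =
      α i * ((nodalErase D i).eval (D.x i) * D.vL i c) := by
  rw [Finset.sum_apply, eval_finsetSum, Finset.sum_eq_single i]
  · simp [constRow]
  · intro j _ hj
    simp [eval_nodalErase_of_ne D hj]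
  · simp

lemma nodal_smul_quotRow (D : EigenData L M) (i : Fin M) :
    (∏ j, (X - C (D.x j))) • quotRow L (D.x i) (D.vL i) =
      mulRight L (nodalErase D i • constRow (D.vL i)) := by
  rw [← mul_nodalErase D i, mul_comm, mul_smul, smul_quotRow (D.left_eigen i), mulRight_mul]

lemma nodal_smul_sum (D : EigenData L M) (α : Fin M → ℂ) :
    (∏ j, (X - C (D.x j))) • ∑ i, α i • quotRow L (D.x i) (D.vL i) =
      mulRight L (∑ i, α i • nodalErase D i • constRow (D.vL i)) := by
  rw [Finset.smul_sum, map_sum]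
  refine Finset.sum_congr rfl fun i _ => ?_
  rw [map_smul, ← nodal_smul_quotRow, smul_comm]

variable [NeZero q]

/-- Clear denominators with ∏ (x - x_j) and cancel L by injectivity of u ↦ uL; evaluation at x_i
then isolates the i-th coefficient. -/
lemma IsNormalized.linearIndependent_quotRow (hL : IsNormalized L N r) (hN : 1 ≤ N) (hr : r < q)
    (hM : M + r = N * q) (D : EigenData L M) :
    LinearIndependent ℂ fun i => quotRow L (D.x i) (D.vL i) := by
  rw [Fintype.linearIndependent_iff]
  intro α hα i
  have h1 := nodal_smul_sum D α
  rw [hα, smul_zero] at h1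
  have h2 := hL.mulRight_injective hN hr hM (h1.symm.trans (map_zero _).symm)
  obtain ⟨c, hc⟩ := Function.ne_iff.1 (D.vL_ne i)
  have h3 := eval_sum_nodalErase D α i c
  rw [h2] at h3
  simpa [eval_nodalErase_self D i, show D.vL i c ≠ 0 from hc] using h3.symm

/-- The quotient attached to any left null vector, at any point x₀, lies in the span of the M
quotients of `D`. This single identity yields both that there are no further eigenvalues and that
the left kernels are lines, without computing deg det L. -/
lemma IsNormalized.quotRow_eq_sum (hL : IsNormalized L N r) (hN : 1 ≤ N) (hr : r < q)
    (hM : M + r = N * q) (D : EigenData L M) {x₀ : ℂ} {u : Fin q → ℂ}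
    (hu : Matrix.vecMul u (evalMat L x₀) = 0) :
    ∃ α : Fin M → ℂ, (∏ j, (X - C (D.x j))) • constRow u =
      (X - C x₀) • ∑ i, α i • nodalErase D i • constRow (D.vL i) := by
  have hR := hL.linearIndependent_quotRow hN hr hM D
  have hmem (i : Fin M) := hL.quotRow_mem hN hr hM (D.left_eigen i)
  have h : LinearIndependent ℂ (fun i => (⟨_, hmem i⟩ : lowDeg q M)) :=
    LinearIndependent.of_comp (lowDeg q M).subtype hR
  have hspan := h.span_eq_top_of_card_eq_finrank'
    (le_antisymm h.fintype_card_le_finrank (by simpa using finrank_lowDeg_le (r := q) M))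
  have hin : (⟨_, hL.quotRow_mem hN hr hM hu⟩ : lowDeg q M) ∈
    Submodule.span ℂ (Set.range fun i => (⟨_, hmem i⟩ : lowDeg q M)) := hspan ▸ Submodule.mem_top
  obtain ⟨α, hα⟩ := (Submodule.mem_span_range_iff_exists_fun ℂ).1 hin
  have hα' : ∑ i, α i • quotRow L (D.x i) (D.vL i) = quotRow L x₀ u := by
    simpa using congrArg Subtype.val hα
  refine ⟨α, hL.mulRight_injective hN hr hM ?_⟩
  rw [mulRight_mul, mulRight_mul, ← nodal_smul_sum, hα', ← smul_quotRow hu, smul_comm]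

lemma IsNormalized.exists_eigenvalue (hL : IsNormalized L N r) (hN : 1 ≤ N) (hr : r < q)
    (hM : M + r = N * q) (D : EigenData L M) {x₀ : ℂ} (h : (evalMat L x₀).det = 0) :
    ∃ i, D.x i = x₀ := by
  obtain ⟨u, hu, h0⟩ := Matrix.exists_vecMul_eq_zero_iff.2 h
  obtain ⟨α, hα⟩ := hL.quotRow_eq_sum hN hr hM D h0
  obtain ⟨c, hc⟩ := Function.ne_iff.1 hu
  have h1 := congrArg (fun w => (w c).eval x₀) hα
  simp only [Pi.smul_apply, smul_eq_mul, eval_mul, eval_sub, eval_X, eval_C, sub_self, zero_mul,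
    constRow, eval_prod, mul_eq_zero, Finset.prod_eq_zero_iff, Finset.mem_univ, true_and] at h1
  obtain ⟨i, hi⟩ := h1.resolve_right hc
  exact ⟨i, (sub_eq_zero.1 hi).symm⟩

lemma IsNormalized.left_kernel (hL : IsNormalized L N r) (hN : 1 ≤ N) (hr : r < q)
    (hM : M + r = N * q) (D : EigenData L M) (i : Fin M) {u : Fin q → ℂ}
    (hu : Matrix.vecMul u (evalMat L (D.x i)) = 0) : ∃ a : ℂ, u = a • D.vL i := by
  obtain ⟨α, hα⟩ := hL.quotRow_eq_sum hN hr hM D hu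
  refine ⟨α i, ?_⟩
  ext c
  have h1 := congrFun hα c
  rw [← mul_nodalErase D i] at h1
  simp only [Pi.smul_apply (M := fun _ => ℂ[X]), smul_eq_mul, mul_assoc] at h1
  -- Both sides carry the factor x - x_i; after cancelling it, evaluation at x_i leaves only the
  -- i-th term.
  have h2 := congrArg (eval (D.x i)) (mul_left_cancel₀ (X_sub_C_ne_zero _) h1)
  rw [eval_sum_nodalErase, eval_mul, constRow, eval_C] at h2
  refine mul_left_cancel₀ (eval_nodalErase_self D i) ?_
  rw [h2, Pi.smul_apply, smul_eq_mul]
  ring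

/-- For a square matrix the left and right kernels have equal dimension, since transposition
preserves rank. -/
lemma IsNormalized.right_kernel (hL : IsNormalized L N r) (hN : 1 ≤ N) (hr : r < q)
    (hM : M + r = N * q) (D : EigenData L M) (i : Fin M) {w : Fin q → ℂ}
    (hw : (evalMat L (D.x i)).mulVec w = 0) : ∃ a : ℂ, w = a • D.vR i := by
  set T := evalMat L (D.x i)
  have h1 : Module.finrank ℂ (LinearMap.ker T.transpose.mulVecLin) ≤ 1 := by
    refine finrank_le_one ⟨D.vL i, by simpa [Matrix.mulVec_transpose] using D.left_eigen i⟩ ?_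
    rintro ⟨u, hu⟩
    obtain ⟨a, ha⟩ := hL.left_kernel hN hr hM D i (u := u)
      (by simpa [Matrix.mulVec_transpose] using hu)
    exact ⟨a, Subtype.ext ha.symm⟩
  have h2 := LinearMap.finrank_range_add_finrank_ker T.transpose.mulVecLin
  have h3 := LinearMap.finrank_range_add_finrank_ker T.mulVecLin
  have h4 : Module.finrank ℂ (LinearMap.range T.transpose.mulVecLin) =
    Module.finrank ℂ (LinearMap.range T.mulVecLin) := Matrix.rank_transpose T
  have h5 : Module.finrank ℂ (LinearMap.ker T.mulVecLin) ≤ 1 := by omega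
  let v₀ : LinearMap.ker T.mulVecLin := ⟨D.vR i, by simpa using D.right_eigen i⟩
  have hv₀ : v₀ ≠ 0 := fun h => D.vR_ne i (congrArg Subtype.val h)
  have h6 : Module.finrank ℂ (LinearMap.ker T.mulVecLin) = 1 :=
    le_antisymm h5 (Module.finrank_pos_iff_exists_ne_zero.2 ⟨v₀, hv₀⟩)
  obtain ⟨a, ha⟩ := (finrank_eq_one_iff_of_nonzero' v₀ hv₀).1 h6 ⟨w, by simpa using hw⟩
  exact ⟨a, (congrArg Subtype.val ha).symm⟩

end Eigenvalues

/-! ### The bilinear form of a matrix of measures. -/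

section Pairing

variable {q p : ℕ} {ν : MatMeasure q p}

/-- The bilinear form `∫ u dν w` on row and column vector polynomials. -/
noncomputable def HasMoments.pairing (h : HasMoments ν) :
    (Fin q → ℂ[X]) →ₗ[ℂ] (Fin p → ℂ[X]) →ₗ[ℂ] ℂ :=
  LinearMap.mk₂ ℂ (fun u w => ∑ b, ∑ a, h.integralPoly b a (u b * w a))
    (fun u₁ u₂ w => by simp [add_mul, Finset.sum_add_distrib])
    (fun c u w => by simp [Finset.mul_sum])
    (fun u w₁ w₂ => by simp [mul_add, Finset.sum_add_distrib])
    (fun c u w => by simp [Finset.mul_sum])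

lemma HasMoments.pairing_apply (h : HasMoments ν) (u : Fin q → ℂ[X]) (w : Fin p → ℂ[X]) :
    h.pairing u w = ∑ b, ∑ a, h.integralPoly b a (u b * w a) := rfl

lemma IsLeftGeronimus.pairing_mulRight {L : Matrix (Fin q) (Fin q) ℂ[X]} {ν' : MatMeasure q p}
    (h : HasMoments ν) (hG : IsLeftGeronimus L ν ν') (u : Fin q → ℂ[X]) (w : Fin p → ℂ[X]) :
    hG.moments.pairing (mulRight L u) w = h.pairing u w := by
  have h1 (c : Fin q) (a : Fin p) : h.integralPoly c a (u c * w a) =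
      ∑ b, hG.moments.integralPoly b a (u c * L c b * w a) := by
    rw [h.integralPoly_apply, ← hG.perturb c a]
    have hm (b : Fin q) : (ν' b a).Integrable
        (fun z => (u c * w a).eval z * evalMat L z c b) := by
      simpa [evalMat] using hG.moments.integrable_eval b a (u c * w a * L c b)
    have hL (b : Fin q) : (ν' b a).Integrable (fun z => evalMat L z c b) :=
      hG.moments.integrable_eval b a (L c b)
    have hc (b : Fin q) : AEStronglyMeasurable (fun z => (u c * w a).eval z) (ν' b a).variation :=
      (hG.moments.integrable_eval b a _).1
    rw [cint_measure_finsetSum _ fun b _ => integrable_density (hL b) (hc b) (hm b)]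
    refine Finset.sum_congr rfl fun b _ => ?_
    rw [cint_density (hL b) (hc b) (hm b), HasMoments.integralPoly_apply]
    congr 1
    ext z
    simp [evalMat]
    ring
  rw [HasMoments.pairing_apply, HasMoments.pairing_apply]
  simp only [h1, mulRight_apply, Finset.sum_mul, map_sum]
  rw [Finset.sum_comm]
  conv_rhs => rw [Finset.sum_comm]
  exact Finset.sum_congr rfl fun a _ => Finset.sum_comm

variable [NeZero q] [NeZero p]

lemma HasMoments.pairing_monom (h : HasMoments ν) (i j : ℕ) :
    h.pairing (monom q i) (monom p j) = momentMatrix ν i j := by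
  simp only [h.pairing_apply, h.integralPoly_apply, momentMatrix, eval_mul]

lemma polyA_eq (F : GaussBorel (momentMatrix ν)) (n : ℕ) :
    polyA F n = ∑ j ∈ Finset.range (n + 1), F.Sbar n j • monom p j := by
  ext1 a
  simp [polyA, smul_eq_C_mul]

lemma polyB_eq (F : GaussBorel (momentMatrix ν)) (n : ℕ) :
    polyB F n = ∑ j ∈ Finset.range (n + 1), (F.S n j / F.H n) • monom q j := by
  ext1 b
  simp only [polyB, smul_eq_C_mul, Finset.sum_apply, Pi.smul_apply]

lemma sum_monom_mem {r : ℕ} [NeZero r] (c : ℕ → ℂ) (n : ℕ) :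
    ∑ j ∈ Finset.range (n + 1), c j • monom r j ∈ lowDeg r (n + 1) :=
  Submodule.sum_mem _ fun j hj => Submodule.smul_mem _ _
    (lowDeg_mono (by have := Finset.mem_range.1 hj; omega) (monom_mem_lowDeg j))

lemma idxCoeff_sum_monom {r : ℕ} [NeZero r] (c : ℕ → ℂ) (n : ℕ) :
    idxCoeff r n (∑ j ∈ Finset.range (n + 1), c j • monom r j) = c n := by
  simp [idxCoeff_monom]

lemma idxCoeff_polyA (F : GaussBorel (momentMatrix ν)) (n : ℕ) : idxCoeff p n (polyA F n) = 1 := by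
  rw [polyA_eq, idxCoeff_sum_monom, F.Sbar_diag]

lemma biorthogonal (h : HasMoments ν) (F : GaussBorel (momentMatrix ν)) :
    Biorthogonal h.pairing (polyB F) (polyA F) where
  left_mem n := polyB_eq F n ▸ sum_monom_mem _ n
  left_lead n := by
    rw [polyB_eq, idxCoeff_sum_monom (fun j => F.S n j / F.H n), F.S_diag]
    exact one_div_ne_zero (F.H_ne n)
  right_mem n := polyA_eq F n ▸ sum_monom_mem _ n
  right_lead n := by
    rw [idxCoeff_polyA]
    exact one_ne_zero
  orth i j := by
    have hf := F.factor i j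
    rw [polyA_eq, polyB_eq]
    simp only [map_sum, LinearMap.sum_apply, map_smul, LinearMap.smul_apply, h.pairing_monom,
      smul_eq_mul]
    calc _ = (F.H i)⁻¹ * ∑ k ∈ Finset.range (i + 1), ∑ l ∈ Finset.range (j + 1),
          F.S i k * momentMatrix ν k l * F.Sbar j l := by
          simp only [Finset.mul_sum]
          rw [Finset.sum_comm]
          exact Finset.sum_congr rfl fun k _ => Finset.sum_congr rfl fun l _ => by ring
      _ = if i = j then 1 else 0 := by
          rw [hf]
          split_ifs <;> simp [F.H_ne i]

end Pairing

/-! ### Boundedness of 1/det L on the support. -/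

section InverseBounds

variable {q p : ℕ} {μ : Fin q → Fin p → ComplexMeasure ℝ} {L : Matrix (Fin q) (Fin q) ℂ[X]}

/-- The support may be unbounded, so compactness is not available; f is split into linear factors,
each bounded below on the support. -/
lemma exists_norm_inv_eval_le (f : ℂ[X]) (hf : ∀ t ∈ matSupport μ, f.eval (t : ℂ) ≠ 0) :
    ∃ K : ℝ, ∀ t ∈ matSupport μ, ‖(f.eval (t : ℂ))⁻¹‖ ≤ K := by
  have hroots : ∀ s : Multiset ℂ, (∀ x ∈ s, ∀ t ∈ matSupport μ, x ≠ (t : ℂ)) →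
      ∃ K : ℝ, ∀ t ∈ matSupport μ, ‖((s.map fun x => X - C x).prod.eval (t : ℂ))⁻¹‖ ≤ K := by
    intro s
    induction s using Multiset.induction_on with
    | empty => exact fun _ => ⟨1, by simp⟩
    | cons x s ih =>
      intro hs
      obtain ⟨K₁, h₁⟩ := exists_norm_inv_sub_le μ (hs x (Multiset.mem_cons_self x s))
      obtain ⟨K₂, h₂⟩ := ih fun y hy => hs y (Multiset.mem_cons_of_mem hy)
      refine ⟨K₁ * K₂, fun t ht => ?_⟩
      rw [Multiset.map_cons, Multiset.prod_cons, eval_mul, mul_inv, norm_mul, eval_sub, eval_X,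
        eval_C]
      exact mul_le_mul (h₁ t ht) (h₂ t ht) (norm_nonneg _) ((norm_nonneg _).trans (h₁ t ht))
  obtain ⟨K, hK⟩ := hroots f.roots fun x hx t ht hxt =>
    hf t ht (hxt ▸ (mem_roots'.1 hx).2)
  refine ⟨‖f.leadingCoeff⁻¹‖ * K, fun t ht => ?_⟩
  have he : f.eval (t : ℂ) =
      f.leadingCoeff * (f.roots.map fun x => X - C x).prod.eval (t : ℂ) := by
    conv_lhs => rw [(IsAlgClosed.splits f).eq_prod_roots]
    rw [eval_mul, eval_C]
  rw [he, mul_inv, norm_mul]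
  exact mul_le_mul_of_nonneg_left (hK t ht) (norm_nonneg _)

lemma evalMat_inv_apply (L : Matrix (Fin q) (Fin q) ℂ[X]) (z : ℂ) (c b : Fin q) :
    (evalMat L z)⁻¹ c b = (L.det.eval z)⁻¹ * (L.adjugate c b).eval z := by
  have h1 := (RingHom.map_adjugate (evalRingHom z) L).symm
  rw [Matrix.inv_def, det_evalMat, Ring.inverse_eq_inv', Matrix.smul_apply, smul_eq_mul]
  congr 1
  exact congrFun (congrFun h1 c) b

lemma integrable_inv_mul (hμ : HasMoments (lift μ))
    (hdet : ∀ t ∈ matSupport μ, L.det.eval (t : ℂ) ≠ 0) (b : Fin q) (a : Fin p) (f : ℂ[X]) :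
    (lift μ b a).Integrable (fun z => f.eval z * (L.det.eval z)⁻¹) := by
  obtain ⟨K, hK⟩ := exists_norm_inv_eval_le L.det hdet
  refine (hμ.integrable_eval b a f).mul_bdd (c := K) ?_ ?_
  · exact (L.det.continuous.measurable.inv).aestronglyMeasurable
  · filter_upwards [ae_lift_mem_matSupport μ b a] with z ⟨t, ht, hz⟩
    exact hz ▸ hK t ht

end InverseBounds

/-! ### Complex measures carried by finitely many points. -/

section AtomicMeasures

variable {M : ℕ}

lemma apply_eq_zero_of_ae_notMem {σ : ComplexMeasure ℂ} {s : Set ℂ}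
    (h : ∀ᵐ z ∂σ.variation, z ∉ s) : σ s = 0 := by
  have h0 : σ.variation s = 0 := measure_eq_zero_iff_ae_notMem.2 h
  have h1 := σ.enorm_measure_le_variation s
  rw [h0] at h1
  simpa using h1

lemma apply_singleton_eq_zero {σ : ComplexMeasure ℂ} {x : ℂ} (h : ∀ᵐ z ∂σ.variation, z ≠ x) :
    σ {x} = 0 :=
  apply_eq_zero_of_ae_notMem h

lemma eq_sum_dirac {σ : ComplexMeasure ℂ} {x : Fin M → ℂ} (hx : Function.Injective x)
    (h : ∀ᵐ z ∂σ.variation, ∃ i, x i = z) :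
    σ = ∑ i, VectorMeasure.dirac (x i) (σ {x i}) := by
  classical
  ext s hs
  have hfin : MeasurableSet (Set.range x) := (Set.finite_range x).measurableSet
  have h1 : σ s = σ (s ∩ Set.range x) + σ (s \ Set.range x) := by
    rw [← VectorMeasure.of_union Set.disjoint_sdiff_inter.symm (hs.inter hfin) (hs.diff hfin),
      Set.inter_union_sdiff]
  have h2 : σ (s \ Set.range x) = 0 := by
    refine apply_eq_zero_of_ae_notMem ?_
    filter_upwards [h] with z hz hz'
    exact hz'.2 hz
  have h3 : s ∩ Set.range x = ⋃ i ∈ Finset.univ.filter (fun i => x i ∈ s), {x i} := by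
    ext z
    simp only [Set.mem_inter_iff, Set.mem_range, Finset.mem_filter, Finset.mem_univ, true_and,
      Set.mem_iUnion, Set.mem_singleton_iff, exists_prop]
    constructor
    · rintro ⟨hz, i, rfl⟩
      exact ⟨i, hz, rfl⟩
    · rintro ⟨i, hi, rfl⟩
      exact ⟨hi, i, rfl⟩
  rw [h1, h2, add_zero, h3, VectorMeasure.of_biUnion_finset
    (fun i _ j _ hij => Set.disjoint_singleton.2 (hx.ne hij)) fun i _ => measurableSet_singleton _,
    Finset.sum_filter, FunLike.coe_sum, Finset.sum_apply]
  refine Finset.sum_congr rfl fun i _ => ?_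
  split_ifs with hi
  · rw [VectorMeasure.dirac_apply_of_mem hs hi]
  · rw [VectorMeasure.dirac_apply_of_notMem hi]

lemma density_singleton {σ : ComplexMeasure ℂ} {f : ℂ → ℂ} (hf : σ.Integrable f)
    (h1 : σ.Integrable (fun _ => (1 : ℂ))) (x : ℂ) : density f σ {x} = f x * σ {x} := by
  have : IsFiniteMeasure σ.variation :=
    (integrable_const_iff_isFiniteMeasure one_ne_zero).1 h1
  rw [density_apply hf, cint, VectorMeasure.integral_congr_ae (g := fun _ => f x),
    VectorMeasure.integral_const, VectorMeasure.restrict_apply _ (measurableSet_singleton x) .univ,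
    Set.univ_inter]
  · rfl
  · rw [VectorMeasure.variation_restrict (measurableSet_singleton x)]
    filter_upwards [ae_restrict_mem (measurableSet_singleton x)] with z hz
    rw [Set.mem_singleton_iff.1 hz]

end AtomicMeasures

/-! ### Existence and uniqueness of the masses ξ_i. -/

section Masses

variable {q p M : ℕ} {μ : Fin q → Fin p → ComplexMeasure ℝ} {L : Matrix (Fin q) (Fin q) ℂ[X]}
  {μ' : MatMeasure q p}

lemma HasMoments.integrable_one {ν : MatMeasure q p} (h : HasMoments ν) (b : Fin q) (a : Fin p) :
    (ν b a).Integrable (fun _ => (1 : ℂ)) := by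
  simpa using h b a 0

lemma integrable_inv (hμ : HasMoments (lift μ))
    (hdet : ∀ t ∈ matSupport μ, L.det.eval (t : ℂ) ≠ 0) (b c : Fin q) (d : Fin q) (a : Fin p)
    (f : ℂ[X]) : (lift μ d a).Integrable (fun z => f.eval z * (evalMat L z)⁻¹ c b) := by
  refine (integrable_inv_mul hμ hdet d a (f * L.adjugate c b)).congr (ae_of_all _ fun z => ?_)
  simp only [evalMat_inv_apply, eval_mul]
  ring

/-- The matrix of measures `L⁻¹ dμ`. -/
noncomputable def invDensity (L : Matrix (Fin q) (Fin q) ℂ[X]) (ν : MatMeasure q p) :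
    MatMeasure q p :=
  fun c a => ∑ b, density (fun z => (evalMat L z)⁻¹ c b) (ν b a)

lemma integrable_inv_entry (hμ : HasMoments (lift μ))
    (hdet : ∀ t ∈ matSupport μ, L.det.eval (t : ℂ) ≠ 0) (b c : Fin q) (d : Fin q) (a : Fin p) :
    (lift μ d a).Integrable (fun z => (evalMat L z)⁻¹ c b) := by
  simpa using integrable_inv hμ hdet b c d a 1

lemma integrable_invDensity (hμ : HasMoments (lift μ))
    (hdet : ∀ t ∈ matSupport μ, L.det.eval (t : ℂ) ≠ 0) (c : Fin q) (a : Fin p) (f : ℂ[X]) :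
    (invDensity L (lift μ) c a).Integrable (fun z => f.eval z) :=
  VectorMeasure.Integrable.finsetSum_vectorMeasure fun b _ =>
    integrable_density (integrable_inv_entry hμ hdet b c b a) (hμ.integrable_eval b a f).1
      (integrable_inv hμ hdet b c b a f)

lemma cint_invDensity (hμ : HasMoments (lift μ))
    (hdet : ∀ t ∈ matSupport μ, L.det.eval (t : ℂ) ≠ 0) (c : Fin q) (a : Fin p) (f : ℂ[X]) :
    cint (invDensity L (lift μ) c a) (fun z => f.eval z) =
      ∑ b, cint (lift μ b a) (fun z => f.eval z * (evalMat L z)⁻¹ c b) := by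
  rw [invDensity, cint_measure_finsetSum _ fun b _ =>
    integrable_density (integrable_inv_entry hμ hdet b c b a) (hμ.integrable_eval b a f).1
      (integrable_inv hμ hdet b c b a f)]
  exact Finset.sum_congr rfl fun b _ => cint_density (integrable_inv_entry hμ hdet b c b a)
    (hμ.integrable_eval b a f).1 (integrable_inv hμ hdet b c b a f)

lemma density_det_invDensity (hμ : HasMoments (lift μ))
    (hdet : ∀ t ∈ matSupport μ, L.det.eval (t : ℂ) ≠ 0) (c : Fin q) (a : Fin p) :
    density (fun z => L.det.eval z) (invDensity L (lift μ) c a) =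
      ∑ b, density (fun z => (L.adjugate c b).eval z) (lift μ b a) := by
  rw [invDensity, density_measure_finsetSum _ fun b _ =>
    integrable_density (integrable_inv_entry hμ hdet b c b a) (hμ.integrable_eval b a _).1
      (integrable_inv hμ hdet b c b a _)]
  refine Finset.sum_congr rfl fun b _ => ?_
  rw [density_density (integrable_inv_entry hμ hdet b c b a) (hμ.integrable_eval b a _).1
      (integrable_inv hμ hdet b c b a _)]
  refine density_congr_ae ?_
  filter_upwards [ae_lift_mem_matSupport μ b a] with z ⟨t, ht, hz⟩
  rw [evalMat_inv_apply, hz, mul_inv_cancel_left₀ (hdet t ht)]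

/-- Apply adj L to L dμ̌ = dμ and use adj(L) L = det(L) I. The right side agrees with that of
`density_det_invDensity`. -/
lemma density_det_perturbed (hG : IsLeftGeronimus L (lift μ) μ') (c : Fin q) (a : Fin p) :
    density (fun z => L.det.eval z) (μ' c a) =
      ∑ b, density (fun z => (L.adjugate c b).eval z) (lift μ b a) := by
  have hm := hG.moments
  have hi (b d : Fin q) : (μ' d a).Integrable
      (fun z => (L.adjugate c b).eval z * evalMat L z b d) := by
    simpa [evalMat] using hm.integrable_eval d a (L.adjugate c b * L b d)
  have hL (b d : Fin q) : (μ' d a).Integrable (fun z => evalMat L z b d) :=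
    hm.integrable_eval d a (L b d)
  have h1 (b : Fin q) : density (fun z => (L.adjugate c b).eval z) (lift μ b a) =
      ∑ d, density (fun z => (L.adjugate c b).eval z * evalMat L z b d) (μ' d a) := by
    rw [← hG.perturb b a, density_measure_finsetSum _ fun d _ =>
      integrable_density (hL b d) (hm.integrable_eval d a _).1 (hi b d)]
    exact Finset.sum_congr rfl fun d _ =>
      density_density (hL b d) (hm.integrable_eval d a _).1 (hi b d)
  simp only [h1]
  rw [Finset.sum_comm, Finset.sum_eq_single c]
  · rw [← density_finsetSum _ fun b _ => hi b c]
    congr 1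
    ext z
    have := congrArg (eval z) (congrFun (congrFun (Matrix.adjugate_mul L) c) c)
    simpa [Matrix.mul_apply, eval_finsetSum, evalMat] using this.symm
  · intro d _ hd
    rw [← density_finsetSum _ fun b _ => hi b d, show (fun z => ∑ b, (L.adjugate c b).eval z *
      evalMat L z b d) = fun _ => 0 from ?_]
    · exact VectorMeasure.withDensity_fun_zero
    ext z
    have := congrArg (eval z) (congrFun (congrFun (Matrix.adjugate_mul L) c) d)
    simpa [Matrix.mul_apply, eval_finsetSum, evalMat, Matrix.one_apply_ne hd.symm] using this
  · simp

lemma ae_eq_zero_of_density_eq_zero {σ : ComplexMeasure ℂ} {f : ℂ → ℂ} (hf : σ.Integrable f)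
    (h : density f σ = 0) : ∀ᵐ z ∂σ.variation, f z = 0 := by
  have h1 := variation_density hf
  rw [h, VectorMeasure.variation_zero, eq_comm, withDensity_eq_zero_iff hf.1.enorm] at h1
  filter_upwards [h1] with z hz
  simpa using hz

lemma ae_ne_of_notMem {x : ℂ} (hx : ∀ t ∈ matSupport μ, x ≠ (t : ℂ)) (b : Fin q) (a : Fin p) :
    ∀ᵐ z ∂(lift μ b a).variation, z ≠ x := by
  filter_upwards [ae_lift_mem_matSupport μ b a] with z ⟨t, ht, hz⟩
  exact hz ▸ (hx t ht).symm

lemma invDensity_singleton (hμ : HasMoments (lift μ))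
    (hdet : ∀ t ∈ matSupport μ, L.det.eval (t : ℂ) ≠ 0) {x : ℂ}
    (hx : ∀ t ∈ matSupport μ, x ≠ (t : ℂ)) (c : Fin q) (a : Fin p) :
    invDensity L (lift μ) c a {x} = 0 := by
  rw [invDensity, FunLike.coe_sum, Finset.sum_apply]
  refine Finset.sum_eq_zero fun b _ => ?_
  rw [density_singleton (integrable_inv_entry hμ hdet b c b a) (hμ.integrable_one b a),
    apply_singleton_eq_zero (ae_ne_of_notMem hx b a), mul_zero]

variable [NeZero q] {N r : ℕ}

lemma IsNormalized.eval_det_ne_zero (hL : IsNormalized L N r) (hN : 1 ≤ N) (hr : r < q)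
    (hM : M + r = N * q) (D : EigenData L M)
    (hD : ∀ i, ∀ t ∈ matSupport μ, D.x i ≠ (t : ℂ)) :
    ∀ t ∈ matSupport μ, L.det.eval (t : ℂ) ≠ 0 := fun t ht h =>
  let ⟨i, hi⟩ := hL.exists_eigenvalue hN hr hM D ((det_evalMat L t).trans h)
  hD i t ht hi

lemma exists_masses (hμ : HasMoments (lift μ)) (hN : 1 ≤ N) (hr : r < q) (hM : M + r = N * q)
    (hL : IsNormalized L N r) (D : EigenData L M)
    (hD : ∀ i, ∀ t ∈ matSupport μ, D.x i ≠ (t : ℂ)) (hG : IsLeftGeronimus L (lift μ) μ') :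
    ∃ ξ : Fin M → Fin p → ℂ, HasMasses D ξ (lift μ) μ' := by
  have hdet := hL.eval_det_ne_zero hN hr hM D hD
  -- Since x_i is off the support of μ, evaluating L dμ̌ = dμ on {x_i} puts the column of atoms in
  -- the kernel of L(x_i).
  have hmass (i : Fin M) (a : Fin p) : ∃ e : ℂ, (fun c => μ' c a {D.x i}) = e • D.vR i := by
    refine hL.right_kernel hN hr hM D i ?_
    ext b
    have h1 := congrArg (fun σ : ComplexMeasure ℂ => σ {D.x i}) (hG.perturb b a)
    rw [apply_singleton_eq_zero (ae_ne_of_notMem (hD i) b a), FunLike.coe_sum,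
      Finset.sum_apply] at h1
    rw [Pi.zero_apply, ← h1]
    change ∑ c, evalMat L (D.x i) b c * μ' c a {D.x i} = _
    refine Finset.sum_congr rfl fun c _ => ?_
    exact (density_singleton (hG.moments.integrable_eval c a (L b c))
      (hG.moments.integrable_one c a) (D.x i)).symm
  choose ξ hξ using hmass
  refine ⟨ξ, fun c a => ?_⟩
  have hi₁ := hG.moments.integrable_eval c a L.det
  have hi₂ := integrable_invDensity hμ hdet c a L.det
  have h0 : density (fun z => L.det.eval z) (μ' c a - invDensity L (lift μ) c a) = 0 := by
    rw [density_measure_sub hi₁ hi₂, density_det_perturbed hG, density_det_invDensity hμ hdet,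
      sub_self]
  have hae : ∀ᵐ z ∂(μ' c a - invDensity L (lift μ) c a).variation, ∃ i, D.x i = z := by
    filter_upwards [ae_eq_zero_of_density_eq_zero (hi₁.sub_vectorMeasure hi₂) h0] with z hz
    exact hL.exists_eigenvalue hN hr hM D ((det_evalMat L z).trans hz)
  rw [← sub_eq_iff_eq_add']
  refine (eq_sum_dirac D.x_injective hae).trans (Finset.sum_congr rfl fun i _ => ?_)
  rw [sub_apply, invDensity_singleton hμ hdet (hD i), sub_zero]
  congr 1
  rw [mul_comm]
  exact congrFun (hξ i a) c

omit [NeZero q] in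
lemma masses_unique {D : EigenData L M} {ξ η : Fin M → Fin p → ℂ} {ν : MatMeasure q p}
    (hξ : HasMasses D ξ ν μ') (hη : HasMasses D η ν μ') : ξ = η := by
  ext i a
  obtain ⟨c, hc⟩ := Function.ne_iff.1 (D.vR_ne i)
  have h1 := add_left_cancel ((hξ c a).symm.trans (hη c a))
  have h2 := congrArg (fun σ : ComplexMeasure ℂ => σ {D.x i}) h1
  have h3 (j : Fin M) (e : ℂ) : (VectorMeasure.dirac (D.x j) e : ComplexMeasure ℂ) {D.x i} =
      if j = i then e else 0 := by
    split_ifs with h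
    · exact VectorMeasure.dirac_apply_of_mem (measurableSet_singleton _) (by simp [h])
    · exact VectorMeasure.dirac_apply_of_notMem (by simpa using fun h' => h (D.x_injective h'))
  simp only [FunLike.coe_sum, Finset.sum_apply, h3, Finset.sum_ite_eq', Finset.mem_univ,
    if_true] at h2
  exact mul_left_cancel₀ hc h2

end Masses

/-! ### The entries E_n^(i) as pairings with the basis R_i. -/

section Coefficients

variable {q p M : ℕ} {μ : Fin q → Fin p → ComplexMeasure ℝ} {L : Matrix (Fin q) (Fin q) ℂ[X]}
  {μ' : MatMeasure q p}

/-- For i = j, differentiate (x - x_i) R_i = v_i^L L at x_i; for i ≠ j, evaluate it at x_j and use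
L(x_j) v_j^R = 0. -/
lemma quotRow_eval_vR (D : EigenData L M) (i j : Fin M) :
    ∑ c, (quotRow L (D.x i) (D.vL i) c).eval (D.x j) * D.vR j c =
      if i = j then scal D i else 0 := by
  have h0 (c : Fin q) : (X - C (D.x i)) * quotRow L (D.x i) (D.vL i) c =
      ∑ b, C (D.vL i b) * L b c := congrFun (smul_quotRow (D.left_eigen i)) c
  split_ifs with h
  · subst h
    have h1 (c : Fin q) : (quotRow L (D.x i) (D.vL i) c).eval (D.x i) =
        ∑ b, D.vL i b * evalDeriv L (D.x i) b c := by
      have := congrArg (fun f => (derivative f).eval (D.x i)) (h0 c)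
      simpa [eval_finsetSum, evalDeriv] using this
    simp only [h1, scal, dotProduct, Matrix.mulVec, Finset.sum_mul, Finset.mul_sum]
    rw [Finset.sum_comm]
    exact Finset.sum_congr rfl fun b _ => Finset.sum_congr rfl fun c _ => mul_assoc _ _ _
  · have h1 (c : Fin q) : (D.x j - D.x i) * (quotRow L (D.x i) (D.vL i) c).eval (D.x j) =
        ∑ b, D.vL i b * evalMat L (D.x j) b c := by
      have := congrArg (eval (D.x j)) (h0 c)
      simpa [eval_finsetSum, evalMat] using this
    refine (mul_eq_zero.1 ?_).resolve_left (sub_ne_zero.2 fun h' => h (D.x_injective h'.symm))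
    rw [Finset.mul_sum]
    simp only [← mul_assoc, h1, Finset.sum_mul]
    rw [Finset.sum_comm]
    refine Finset.sum_eq_zero fun b _ => ?_
    simp only [mul_assoc, ← Finset.mul_sum]
    rw [show ∑ c, evalMat L (D.x j) b c * D.vR j c = 0 from congrFun (D.right_eigen j) b, mul_zero]

lemma quotRow_mul_inv (D : EigenData L M) (i : Fin M) {z : ℂ} (hz : L.det.eval z ≠ 0)
    (hz' : z ≠ D.x i) (b : Fin q) :
    ∑ c, (quotRow L (D.x i) (D.vL i) c).eval z * (evalMat L z)⁻¹ c b =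
      -(D.vL i b / (D.x i - z)) := by
  have h0 (c : Fin q) : (z - D.x i) * (quotRow L (D.x i) (D.vL i) c).eval z =
      Matrix.vecMul (D.vL i) (evalMat L z) c := by
    have := congrArg (eval z) (congrFun (smul_quotRow (D.left_eigen i)) c)
    simpa [eval_mulRight, constRow, Matrix.vecMul, dotProduct] using this
  have h1 : ∑ c, Matrix.vecMul (D.vL i) (evalMat L z) c * (evalMat L z)⁻¹ c b = D.vL i b := by
    have hu : IsUnit (evalMat L z).det := by
      rw [det_evalMat]
      exact hz.isUnit
    change Matrix.vecMul (Matrix.vecMul (D.vL i) (evalMat L z)) (evalMat L z)⁻¹ b = _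
    rw [Matrix.vecMul_vecMul, Matrix.mul_nonsing_inv _ hu, Matrix.vecMul_one]
  have hne : D.x i - z ≠ 0 := sub_ne_zero.2 hz'.symm
  rw [← h1, ← neg_div, eq_div_iff hne, Finset.sum_mul, ← Finset.sum_neg_distrib]
  refine Finset.sum_congr rfl fun c _ => ?_
  rw [← h0]
  ring

variable [NeZero q] [NeZero p]

/-- On the support of μ, R_i L⁻¹ = -v_i^L/(x_i - t), so the density part of μ̌ pairs to -ℂ_n^(i). Of
the atoms only the one at x_i survives, and it contributes 𝕎_n^(i). -/
lemma bbC_sub_bbW (hμ : HasMoments (lift μ)) (F : GaussBorel (momentMatrix (lift μ)))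
    (D : EigenData L M) (hD : ∀ i, ∀ t ∈ matSupport μ, D.x i ≠ (t : ℂ))
    (hdet : ∀ t ∈ matSupport μ, L.det.eval (t : ℂ) ≠ 0) (hμ' : HasMoments μ')
    {ξ : Fin M → Fin p → ℂ} (hξ : HasMasses D ξ (lift μ) μ') (n : ℕ) (i : Fin M) :
    bbC F D n i - bbW F D ξ n i =
      -hμ'.pairing (quotRow L (D.x i) (D.vL i)) (polyA F n) := by
  set R := quotRow L (D.x i) (D.vL i) with hR
  set w := polyA F n
  have h1 (c : Fin q) (a : Fin p) : hμ'.integralPoly c a (R c * w a) =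
      ∑ b, cint (lift μ b a) (fun z => (R c * w a).eval z * (evalMat L z)⁻¹ c b) +
        ∑ j, (R c * w a).eval (D.x j) * (D.vR j c * ξ j a) := by
    rw [hμ'.integralPoly_apply, show μ' c a = invDensity L (lift μ) c a +
        ∑ j, VectorMeasure.dirac (D.x j) (D.vR j c * ξ j a) from hξ c a, cint_measure_add
      (integrable_invDensity hμ hdet c a (R c * w a))
      (VectorMeasure.Integrable.finsetSum_vectorMeasure fun j _ => integrable_dirac _ _),
      cint_measure_finsetSum _ fun j _ => integrable_dirac _ _]
    simp only [cint_dirac]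
    congr 1
    exact cint_invDensity hμ hdet c a (R c * w a)
  have h2 (a : Fin p) (b : Fin q) :
      ∑ c, cint (lift μ b a) (fun z => (R c * w a).eval z * (evalMat L z)⁻¹ c b) =
        -(D.vL i b * cint (lift μ b a) (fun z => (w a).eval z / (D.x i - z))) := by
    rw [← cint_finsetSum _ fun c _ => integrable_inv hμ hdet b c b a _, ← cint_const_mul,
      ← cint_neg]
    refine cint_congr_ae ?_
    filter_upwards [ae_lift_mem_matSupport μ b a] with z ⟨t, ht, hz⟩
    have := quotRow_mul_inv D i (z := z) (hz ▸ hdet t ht) (hz ▸ (hD i t ht).symm) b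
    calc ∑ c, (R c * w a).eval z * (evalMat L z)⁻¹ c b
        = (w a).eval z * ∑ c, (R c).eval z * (evalMat L z)⁻¹ c b := by
          rw [Finset.mul_sum]
          exact Finset.sum_congr rfl fun c _ => by rw [eval_mul]; ring
      _ = _ := by
          rw [this]
          ring
  have h3 (a : Fin p) : ∑ c, ∑ j, (R c * w a).eval (D.x j) * (D.vR j c * ξ j a) =
      scal D i * (ξ i a * (w a).eval (D.x i)) := by
    rw [Finset.sum_comm, Finset.sum_eq_single i]
    · rw [← (quotRow_eval_vR D i i).trans (if_pos rfl), Finset.sum_mul]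
      exact Finset.sum_congr rfl fun c _ => by rw [eval_mul]; ring
    · intro j _ hj
      have := (quotRow_eval_vR D i j).trans (if_neg hj.symm)
      calc ∑ c, (R c * w a).eval (D.x j) * (D.vR j c * ξ j a)
          = (∑ c, (R c).eval (D.x j) * D.vR j c) * ((w a).eval (D.x j) * ξ j a) := by
            rw [Finset.sum_mul]
            exact Finset.sum_congr rfl fun c _ => by rw [eval_mul]; ring
        _ = 0 := by rw [this, zero_mul]
    · simp
  rw [hμ'.pairing_apply, Finset.sum_comm]
  simp only [h1, Finset.sum_add_distrib, h3]
  rw [bbC, bbW, neg_add, sub_eq_add_neg]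
  congr 1
  · simp only [cauchyC, Finset.mul_sum]
    rw [Finset.sum_comm, ← Finset.sum_neg_distrib]
    refine Finset.sum_congr rfl fun a _ => ?_
    rw [Finset.sum_comm, ← Finset.sum_neg_distrib]
    refine Finset.sum_congr rfl fun b _ => ?_
    rw [h2, neg_neg]
  · rw [Finset.mul_sum]

end Coefficients

/-! ### Application of the abstract formulas. -/

variable {q p : ℕ} [NeZero q] [NeZero p] {N r M : ℕ} {μ : Fin q → Fin p → ComplexMeasure ℝ}
  {L : Matrix (Fin q) (Fin q) ℂ[X]} {μ' : MatMeasure q p}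

lemma geronimusData (hμ : HasMoments (lift μ)) (F : GaussBorel (momentMatrix (lift μ)))
    (hN : 1 ≤ N) (hr : r < q) (hM : M + r = N * q) (hL : IsNormalized L N r) (D : EigenData L M)
    (hD : ∀ i, ∀ t ∈ matSupport μ, D.x i ≠ (t : ℂ)) (hG : IsLeftGeronimus L (lift μ) μ')
    (F' : GaussBorel (momentMatrix μ')) {ξ : Fin M → Fin p → ℂ}
    (hξ : HasMasses D ξ (lift μ) μ') :
    GeronimusData hμ.pairing hG.moments.pairing (polyB F) (polyB F') (polyA F) (polyA F')
      (mulRight L) (fun i => quotRow L (D.x i) (D.vL i))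
      (fun n i => bbC F D n i - bbW F D ξ n i) where
  orth := biorthogonal hμ F
  orth' := biorthogonal hG.moments F'
  monic := idxCoeff_polyA F
  monic' := idxCoeff_polyA F'
  perturb := hG.pairing_mulRight hμ
  raise_mem := hL.mulRight_mem hN hr hM
  raise_lead := hL.idxCoeff_mulRight hN hr hM
  indep := hL.linearIndependent_quotRow hN hr hM D
  low i := hL.quotRow_mem hN hr hM (D.left_eigen i)
  coeff := bbC_sub_bbW hμ F D hD (hL.eval_det_ne_zero hN hr hM D hD) hG.moments hξ

/-- Evaluation of a component of a vector polynomial. -/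
noncomputable def evalEntry {m : ℕ} (b : Fin m) (y : ℂ) : (Fin m → ℂ[X]) →ₗ[ℂ] ℂ :=
  leval y ∘ₗ LinearMap.proj b

lemma evalEntry_apply {m : ℕ} (b : Fin m) (y : ℂ) (u : Fin m → ℂ[X]) :
    evalEntry b y u = (u b).eval y := rfl

lemma bbK_eq_sum {ν : MatMeasure q p} (F : GaussBorel (momentMatrix ν)) (D : EigenData L M)
    (ξ : Fin M → Fin p → ℂ) (n : ℕ) (i : Fin M) (y : ℂ) (b : Fin q) :
    bbK F D ξ n i y b =
      ∑ k ∈ Finset.range (n + 1), (bbC F D k i - bbW F D ξ k i) * (polyB F k b).eval y := by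
  simp only [bbK, kernelKC, kernelK, bbC, bbW, sub_mul, Finset.sum_sub_distrib, Finset.mul_sum,
    Finset.sum_mul]
  congr 1
  · rw [Finset.sum_comm]
    exact Finset.sum_congr rfl fun k _ => Finset.sum_congr rfl fun c _ => by ring
  · rw [Finset.sum_comm]
    exact Finset.sum_congr rfl fun k _ => Finset.sum_congr rfl fun c _ => by ring

omit [NeZero q] [NeZero p] in
lemma sum_vL_mul_eval (D : EigenData L M) (i : Fin M) {y : ℂ} (hy : y ≠ D.x i) (b : Fin q) :
    ∑ c, D.vL i c / (y - D.x i) * (L c b).eval y = (quotRow L (D.x i) (D.vL i) b).eval y := by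
  have h0 := congrArg (eval y) (congrFun (smul_quotRow (D.left_eigen i)) b)
  simp only [Pi.smul_apply, smul_eq_mul, eval_mul, eval_sub, eval_X, eval_C, eval_mulRight,
    constRow] at h0
  refine mul_left_cancel₀ (sub_ne_zero.2 hy) ?_
  rw [h0, Finset.mul_sum]
  refine Finset.sum_congr rfl fun c _ => ?_
  rw [← mul_assoc, mul_div_cancel₀ _ (sub_ne_zero.2 hy)]
  rfl

/-- Linearity in the last column moves the sum against L inside the determinant, where v_i^L L(y)/(y
- x_i) becomes R_i(y) and each B_k becomes B_k L. -/
lemma sum_detB_mul {ν : MatMeasure q p} (F : GaussBorel (momentMatrix ν)) (D : EigenData L M)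
    (ξ : Fin M → Fin p → ℂ) (hM : 1 ≤ M) (n : ℕ) {y : ℂ} (hy : ∀ i, y ≠ D.x i) (b : Fin q) :
    ∑ c, detB F D ξ n y c * (L c b).eval y =
      Matrix.det (Matrix.of fun i j : Fin M => if (j : ℕ) + 1 < M then
        bbC F D (n - M + 1 + j) i - bbW F D ξ (n - M + 1 + j) i
      else evalEntry b y (quotRow L (D.x i) (D.vL i) + ∑ k ∈ Finset.range (n - M + 1),
        (bbC F D k i - bbW F D ξ k i) • mulRight L (polyB F k))) := by
  obtain ⟨d, hd⟩ := exists_det_lastCol hM fun i j : Fin M =>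
    bbC F D (n - M + 1 + j) i - bbW F D ξ (n - M + 1 + j) i
  simp only [detB, hd]
  simp only [mul_comm (d _), ← smul_eq_mul (a := eval y _), ← map_smul d, ← map_sum d]
  congr 1
  ext i
  have h1 (k : ℕ) : evalEntry b y ((bbC F D k i - bbW F D ξ k i) • mulRight L (polyB F k)) =
      ∑ c, (L c b).eval y * ((bbC F D k i - bbW F D ξ k i) * (polyB F k c).eval y) := by
    rw [map_smul, evalEntry_apply, eval_mulRight, smul_eq_mul, Finset.mul_sum]
    refine Finset.sum_congr rfl fun c _ => ?_
    rw [evalMat, Matrix.map_apply]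
    ring
  rw [map_add, evalEntry_apply, ← sum_vL_mul_eval D i (hy i), map_sum, Finset.sum_apply]
  simp only [h1, Pi.smul_apply, smul_eq_mul, mul_add, Finset.sum_add_distrib, bbK_eq_sum,
    Finset.mul_sum]
  rw [add_comm, Finset.sum_comm]
  exact congrArg₂ (· + ·) (Finset.sum_congr rfl fun c _ => mul_comm _ _) rfl

end MixedGeronimus

theorem mainTheorem6 {q p : ℕ} [NeZero q] [NeZero p]
    -- the matrix of measures on the real line, with its biorthogonal families
    (μ : Fin q → Fin p → ComplexMeasure ℝ)
    (hμ : MixedGeronimus.HasMoments (MixedGeronimus.lift μ))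
    (F : MixedGeronimus.GaussBorel (MixedGeronimus.momentMatrix (MixedGeronimus.lift μ)))
    -- the perturbing matrix polynomial, with `deg det L = M = N q - r` simple eigenvalues off `Δ`
    (N r M : ℕ) (hN : 1 ≤ N) (hr : r < q) (hM : M + r = N * q)
    (L : Matrix (Fin q) (Fin q) (Polynomial ℂ))
    (hL : MixedGeronimus.IsNormalized L N r)
    (D : MixedGeronimus.EigenData L M)
    (hD : ∀ i, ∀ t ∈ MixedGeronimus.matSupport μ, D.x i ≠ (t : ℂ))
    -- the perturbed matrix of measures, assumed to have biorthogonal families as well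
    (μ' : MixedGeronimus.MatMeasure q p)
    (hμ' : MixedGeronimus.IsLeftGeronimus L (MixedGeronimus.lift μ) μ')
    (F' : MixedGeronimus.GaussBorel (MixedGeronimus.momentMatrix μ')) :
    (∃! ξ : Fin M → Fin p → ℂ,
      MixedGeronimus.HasMasses D ξ (MixedGeronimus.lift μ) μ') ∧
    ∀ ξ : Fin M → Fin p → ℂ, MixedGeronimus.HasMasses D ξ (MixedGeronimus.lift μ) μ' →
      (∀ n, M ≤ n + 1 → MixedGeronimus.tau F D ξ n ≠ 0) ∧
      ∀ n, M ≤ n →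
        (∀ (b : Fin q) (y : ℂ), (∀ i, y ≠ D.x i) →
          (MixedGeronimus.polyB F' n b).eval y =
            -(1 / MixedGeronimus.tau F D ξ n) *
              ∑ c, MixedGeronimus.detB F D ξ n y c * (L c b).eval y) ∧
        (∀ (a : Fin p) (x : ℂ),
          (MixedGeronimus.polyA F' n a).eval x =
            1 / MixedGeronimus.tau F D ξ (n - 1) * MixedGeronimus.detA F D ξ n x a) := by
  open MixedGeronimus in
  have hM1 : 1 ≤ M := by
    have : q ≤ N * q := Nat.le_mul_of_pos_left q hN
    omega
  obtain ⟨ξ₀, hξ₀⟩ := exists_masses hμ hN hr hM hL D hD hμ'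
  refine ⟨⟨ξ₀, hξ₀, fun η hη => masses_unique hη hξ₀⟩, fun ξ hξ => ?_⟩
  have G := geronimusData hμ F hN hr hM hL D hD hμ' F' hξ
  refine ⟨fun n _ => G.det_ne_zero (n + 1 - M), fun n hn => ?_⟩
  obtain ⟨m, rfl⟩ : ∃ m, n = m + M := ⟨n - M, by omega⟩
  refine ⟨fun b y hy => ?_, fun a x => ?_⟩
  · have hτ : tau F D ξ (m + M) ≠ 0 := G.det_ne_zero _
    have h1 := G.det_left hM1 m (evalEntry b y)
    rw [sum_detB_mul F D ξ hM1 (m + M) hy b, Nat.add_sub_cancel, h1]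
    -- The columns of τ_n start at k = m + 1; for τ_{n-1}, used for Ǎ_n, they start at k = m.
    rw [tau, show m + M + 1 - M = m + 1 by omega] at hτ ⊢
    rw [evalEntry_apply, neg_mul_neg, ← mul_assoc, one_div_mul_cancel hτ, one_mul]
  · have hτ : tau F D ξ (m + M - 1) ≠ 0 := G.det_ne_zero _
    have h1 := G.det_right m (evalEntry a x)
    simp only [evalEntry_apply] at h1
    rw [detA, Nat.add_sub_cancel, h1]
    rw [tau, show m + M - 1 + 1 - M = m by omega] at hτ ⊢
    rw [← mul_assoc, one_div_mul_cancel hτ, one_mul]
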